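/- Let $(\widetilde M, g, J)$ be a Kähler manifold of real dimension $2m$, that is, a smooth Riemannian manifold with Levi-Civita connection $\widetilde\nabla$ and a smooth endomorphism field $J$ with $J^2=-1$, $g(JX,JY)=g(X,Y)$ and $\widetilde\nabla J=0$. Let $M$ be an $n$-dimensional (immersed) submanifold of $\widetilde M$, $n>1$, with the induced metric. For vector fields $X,Y$ on $M$ and normal vector fields $\xi$ write $$\widetilde\nabla_XY=\nabla_XY+\sigma(X,Y),\qquad \widetilde\nabla_X\xi=-A_\xi X+D_X\xi,$$ the decompositions into tangential and normal components; so $\nabla$ is the Levi-Civita connection of $M$, $\sigma$ the second fundamental form and $D$ the normal connection. Let $R$ and $R^\perp$ be the curvature tensors of $\nabla$ and $D$, with the convention $R(X,Y)=\nabla_X\nabla_Y-\nabla_Y\nabla_X-\nabla_{[X,Y]}$ and likewise for $R^\perp$, and let $f\xi$ be the normal component of $J\xi$. Assume that 1. $M$ is totally real: $J(T_pM)\subset (T_pM)^\perp$ for every $p\in M$; 2. $f$ is parallel in the normal bundle (the case $f=0$ being allowed): $D_X(f\xi)=f(D_X\xi)$ for all vector fields $X$ on $M$ and all normal vector fields $\xi$;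 3. $M$ is semiparallel: $R^\perp(X,Y)\sigma(Z,U)-\sigma(R(X,Y)Z,U)-\sigma(Z,R(X,Y)U)=0$ for all vector fields $X,Y,Z,U$ on $M$; 4. $M$ has constant (sectional) curvature $c\in\mathbb R$. Then $c=0$, i.e. $M$ is flat, or $\sigma=0$, i.e. $M$ is a totally geodesic submanifold of $\widetilde M$. -/

import Mathlib

open Bundle Manifold
open scoped Manifold ContDiff

noncomputable section

section Kaehler

variable {E : Type*} [NormedAddCommGroup E] [NormedSpace ℝ E] [FiniteDimensional ℝ E]
  {N : Type*} [TopologicalSpace N] [ChartedSpace E N] [IsManifold 𝓘(ℝ, E) ∞ N]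

/-- `cov` is the Levi-Civita connection of the Riemannian manifold `(N, g)`: the smooth,
torsion-free, metric connection on the tangent bundle (it is unique on smooth vector fields).
Here `cov Y x v` is `∇̃_v Y`. -/
structure IsLeviCivita
    (g : ContMDiffRiemannianMetric 𝓘(ℝ, E) ∞ E (fun x : N => TangentSpace 𝓘(ℝ, E) x))
    (cov : CovariantDerivative 𝓘(ℝ, E) E (fun x : N => TangentSpace 𝓘(ℝ, E) x)) : Prop where
  smooth : cov.ContMDiffCovariantDerivative ∞
  metric : ∀ (Y Z : ∀ x : N, TangentSpace 𝓘(ℝ, E) x) (x : N),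
    MDifferentiableAt 𝓘(ℝ, E) 𝓘(ℝ, E).tangent (fun y => (⟨y, Y y⟩ : TangentBundle 𝓘(ℝ, E) N)) x →
    MDifferentiableAt 𝓘(ℝ, E) 𝓘(ℝ, E).tangent (fun y => (⟨y, Z y⟩ : TangentBundle 𝓘(ℝ, E) N)) x →
    ∀ v : TangentSpace 𝓘(ℝ, E) x,
      mfderiv 𝓘(ℝ, E) 𝓘(ℝ, ℝ) (fun y => g.inner y (Y y) (Z y)) x v =
        g.inner x (cov Y x v) (Z x) + g.inner x (Y x) (cov Z x v)
  torsion_free : cov.torsion = 0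

/-- `(N, g, J)` is a Kähler manifold with Levi-Civita connection `cov`: `J` is a smooth almost
complex structure, orthogonal with respect to the metric `g` and parallel (hence integrable, with
closed fundamental form). -/
structure IsKaehler
    (g : ContMDiffRiemannianMetric 𝓘(ℝ, E) ∞ E (fun x : N => TangentSpace 𝓘(ℝ, E) x))
    (cov : CovariantDerivative 𝓘(ℝ, E) E (fun x : N => TangentSpace 𝓘(ℝ, E) x))
    (J : ∀ x : N, TangentSpace 𝓘(ℝ, E) x →L[ℝ] TangentSpace 𝓘(ℝ, E) x) : Prop where
  leviCivita : IsLeviCivita g cov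
  smooth_J : ContMDiff 𝓘(ℝ, E) (𝓘(ℝ, E).prod 𝓘(ℝ, E →L[ℝ] E)) ∞
    (fun x : N => TotalSpace.mk' (E →L[ℝ] E)
      (E := fun x : N => TangentSpace 𝓘(ℝ, E) x →L[ℝ] TangentSpace 𝓘(ℝ, E) x) x (J x))
  J_sq : ∀ (x : N) (v : TangentSpace 𝓘(ℝ, E) x), J x (J x v) = -v
  J_isometry : ∀ (x : N) (v w : TangentSpace 𝓘(ℝ, E) x),
    g.inner x (J x v) (J x w) = g.inner x v w
  parallel_J : ∀ (Y : ∀ x : N, TangentSpace 𝓘(ℝ, E) x) (x : N),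
    MDifferentiableAt 𝓘(ℝ, E) 𝓘(ℝ, E).tangent (fun y => (⟨y, Y y⟩ : TangentBundle 𝓘(ℝ, E) N)) x →
    ∀ v : TangentSpace 𝓘(ℝ, E) x, cov (fun y => J y (Y y)) x v = J x (cov Y x v)

end Kaehler

namespace Submfd

section Basic

variable {F : Type*} [NormedAddCommGroup F] [NormedSpace ℝ F]
  {M : Type*} [TopologicalSpace M] [ChartedSpace F M]
  {E : Type*} [NormedAddCommGroup E] [NormedSpace ℝ E]
  {N : Type*} [TopologicalSpace N] [ChartedSpace E N]

variable (F E) in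
/-- `ι : M → N` is a smooth immersion, i.e. exhibits `M` as an (immersed) submanifold of `N`. -/
structure IsImmersed (ι : M → N) : Prop where
  smooth : ContMDiff 𝓘(ℝ, F) 𝓘(ℝ, E) ∞ ι
  injective : ∀ p : M, Function.Injective (mfderiv 𝓘(ℝ, F) 𝓘(ℝ, E) ι p)

variable (F E) in
/-- The differential of `ι`, as a map `T_pM → T_{ι p}N`. -/
def dι (ι : M → N) (p : M) : TangentSpace 𝓘(ℝ, F) p →L[ℝ] TangentSpace 𝓘(ℝ, E) (ι p) :=
  mfderiv 𝓘(ℝ, F) 𝓘(ℝ, E) ι p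

/-- Smooth vector fields on `M`. -/
def IsSmoothField [IsManifold 𝓘(ℝ, F) ∞ M] (X : ∀ p : M, TangentSpace 𝓘(ℝ, F) p) : Prop :=
  ContMDiff 𝓘(ℝ, F) 𝓘(ℝ, F).tangent ∞ (fun p => (⟨p, X p⟩ : TangentBundle 𝓘(ℝ, F) M))

variable (F) in
/-- Smooth vector fields of `N` along `ι`, i.e. smooth sections of the pullback of `TN`. -/
def IsSmoothAlong [IsManifold 𝓘(ℝ, E) ∞ N] (ι : M → N)
    (ξ : ∀ p : M, TangentSpace 𝓘(ℝ, E) (ι p)) : Prop :=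
  ContMDiff 𝓘(ℝ, F) 𝓘(ℝ, E).tangent ∞ (fun p => (⟨ι p, ξ p⟩ : TangentBundle 𝓘(ℝ, E) N))

/-- The derivative `∇̃_v s` of a vector field `s` of `N` along `ι` in the direction `v ∈ T_pM`, i.e.
the pullback to `M` of the connection `cov` on `TN`. If `(e_i)` is the coordinate frame of `N`
around `ι p` and `s = ∑ s^i (e_i ∘ ι)`, then it is `∑ ds^i(v) e_i + ∑ s^i(p) ∇̃_{dι v} e_i`;
`FiberBundle.extend` is the extension `∑ s^i(p) e_i` of `s p` with constant coefficients in that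
frame. -/
def covAlong [IsManifold 𝓘(ℝ, E) ∞ N]
    (cov : CovariantDerivative 𝓘(ℝ, E) E (fun x : N => TangentSpace 𝓘(ℝ, E) x))
    (ι : M → N) (s : ∀ p : M, TangentSpace 𝓘(ℝ, E) (ι p)) (p : M) (v : TangentSpace 𝓘(ℝ, F) p) :
    TangentSpace 𝓘(ℝ, E) (ι p) :=
  let e := trivializationAt E (fun x : N => TangentSpace 𝓘(ℝ, E) x) (ι p)
  e.symm (ι p) (mfderiv 𝓘(ℝ, F) 𝓘(ℝ, E) (fun q => (e ⟨ι q, s q⟩).2) p v)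
    + cov (FiberBundle.extend E (s p)) (ι p) (dι F E ι p v)

end Basic

section Metric

variable {F : Type*} [NormedAddCommGroup F] [NormedSpace ℝ F]
  {M : Type*} [TopologicalSpace M] [ChartedSpace F M]
  {E : Type*} [NormedAddCommGroup E] [NormedSpace ℝ E] [FiniteDimensional ℝ E]
  {N : Type*} [TopologicalSpace N] [ChartedSpace E N] [IsManifold 𝓘(ℝ, E) ∞ N]
  (g : ContMDiffRiemannianMetric 𝓘(ℝ, E) ∞ E (fun x : N => TangentSpace 𝓘(ℝ, E) x))
  (cov : CovariantDerivative 𝓘(ℝ, E) E (fun x : N => TangentSpace 𝓘(ℝ, E) x))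
  (J : ∀ x : N, TangentSpace 𝓘(ℝ, E) x →L[ℝ] TangentSpace 𝓘(ℝ, E) x) (ι : M → N)

/-- The induced metric on `M`. -/
def metric (p : M) (v w : TangentSpace 𝓘(ℝ, F) p) : ℝ :=
  g.inner (ι p) (dι F E ι p v) (dι F E ι p w)

/-- Every `w ∈ T_{ι p}N` is the sum of a tangential vector `dι v` and a vector that is orthogonal
to the submanifold. -/
lemma exists_tangentPart (p : M) (w : TangentSpace 𝓘(ℝ, E) (ι p)) :
    ∃ v : TangentSpace 𝓘(ℝ, F) p, ∀ u : TangentSpace 𝓘(ℝ, F) p,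
      g.inner (ι p) (w - dι F E ι p v) (dι F E ι p u) = 0 := by
  have : FiniteDimensional ℝ (TangentSpace 𝓘(ℝ, E) (ι p)) :=
    inferInstanceAs (FiniteDimensional ℝ E)
  let B : LinearMap.BilinForm ℝ (TangentSpace 𝓘(ℝ, E) (ι p)) :=
    LinearMap.mk₂ ℝ (fun a b => g.inner (ι p) a b) (by simp) (by simp) (by simp) (by simp)
  have hB : ∀ a b, B a b = g.inner (ι p) a b := fun _ _ => rfl
  have hrefl : B.IsRefl := fun a b h => by
    rw [hB, g.symm]; exact h
  let W : Submodule ℝ (TangentSpace 𝓘(ℝ, E) (ι p)) := LinearMap.range (dι F E ι p).toLinearMap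
  have hdisj : Disjoint W (B.orthogonal W) := by
    rw [Submodule.disjoint_def]
    intro a ha hao
    by_contra hne
    have h1 : B a a = 0 := hao a ha
    have h2 := g.pos (ι p) a hne
    rw [← hB, h1] at h2
    exact lt_irrefl _ h2
  have hcompl := (LinearMap.BilinForm.isCompl_orthogonal_iff_disjoint hrefl).2 hdisj
  obtain ⟨a, ha, b, hb, hab⟩ := Submodule.mem_sup.1 (hcompl.sup_eq_top ▸ Submodule.mem_top (x := w))
  obtain ⟨v, hv⟩ := ha
  refine ⟨v, fun u => ?_⟩
  have hwb : w - dι F E ι p v = b := by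
    rw [← hab, ← hv]; exact add_sub_cancel_left _ _
  rw [hwb, g.symm]
  exact hb _ ⟨u, rfl⟩

/-- The tangential component of `w ∈ T_{ι p}N`, as a vector of `T_pM` (unique if `ι` is an
immersion). -/
def tangentPart (p : M) (w : TangentSpace 𝓘(ℝ, E) (ι p)) : TangentSpace 𝓘(ℝ, F) p :=
  (exists_tangentPart g ι p w).choose

variable (F) in
/-- The normal component of `w ∈ T_{ι p}N`. -/
def normalPart (p : M) (w : TangentSpace 𝓘(ℝ, E) (ι p)) : TangentSpace 𝓘(ℝ, E) (ι p) :=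
  w - dι F E ι p (tangentPart g ι p w)

variable (F) in
/-- Normal vector fields. -/
def IsNormal (ξ : ∀ p : M, TangentSpace 𝓘(ℝ, E) (ι p)) : Prop :=
  ∀ (p : M) (v : TangentSpace 𝓘(ℝ, F) p), g.inner (ι p) (dι F E ι p v) (ξ p) = 0

variable (F) in
/-- The endomorphism `f` of the normal bundle, `f ξ` being the normal part of `J ξ`. -/
def fOp (ξ : ∀ p : M, TangentSpace 𝓘(ℝ, E) (ι p)) (p : M) : TangentSpace 𝓘(ℝ, E) (ι p) :=
  normalPart F g ι p (J (ι p) (ξ p))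

variable (F) in
/-- `J T_pM ⊆ (T_pM)^⊥` for all `p`. -/
def IsTotallyReal : Prop :=
  ∀ (p : M) (v w : TangentSpace 𝓘(ℝ, F) p),
    g.inner (ι p) (J (ι p) (dι F E ι p v)) (dι F E ι p w) = 0

variable [IsManifold 𝓘(ℝ, F) ∞ M]

/-- The induced connection `∇_X Y` of the submanifold, the tangential part of `∇̃_X Y`. If `cov` is
the Levi-Civita connection of `N`, it is the Levi-Civita connection of the induced metric. -/
def nabla (X Y : ∀ p : M, TangentSpace 𝓘(ℝ, F) p) (p : M) : TangentSpace 𝓘(ℝ, F) p :=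
  tangentPart g ι p (covAlong cov ι (fun q => dι F E ι q (Y q)) p (X p))

/-- The second fundamental form `σ(X, Y)`, the normal part of `∇̃_X Y`. -/
def sff (X Y : ∀ p : M, TangentSpace 𝓘(ℝ, F) p) (p : M) : TangentSpace 𝓘(ℝ, E) (ι p) :=
  normalPart F g ι p (covAlong cov ι (fun q => dι F E ι q (Y q)) p (X p))

/-- The normal connection `D_X ξ`, the normal part of `∇̃_X ξ`. -/
def normalConn (X : ∀ p : M, TangentSpace 𝓘(ℝ, F) p) (ξ : ∀ p : M, TangentSpace 𝓘(ℝ, E) (ι p))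
    (p : M) : TangentSpace 𝓘(ℝ, E) (ι p) :=
  normalPart F g ι p (covAlong cov ι ξ p (X p))

/-- The curvature `R(X, Y)Z = ∇_X ∇_Y Z - ∇_Y ∇_X Z - ∇_[X,Y] Z` of the submanifold. -/
def curv (X Y Z : ∀ p : M, TangentSpace 𝓘(ℝ, F) p) (p : M) : TangentSpace 𝓘(ℝ, F) p :=
  nabla g cov ι X (nabla g cov ι Y Z) p - nabla g cov ι Y (nabla g cov ι X Z) p
    - nabla g cov ι (VectorField.mlieBracket 𝓘(ℝ, F) X Y) Z p

/-- The curvature `R^⊥(X, Y)ξ = D_X D_Y ξ - D_Y D_X ξ - D_[X,Y] ξ` of the normal connection. -/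
def normalCurv (X Y : ∀ p : M, TangentSpace 𝓘(ℝ, F) p)
    (ξ : ∀ p : M, TangentSpace 𝓘(ℝ, E) (ι p)) (p : M) : TangentSpace 𝓘(ℝ, E) (ι p) :=
  normalConn g cov ι X (normalConn g cov ι Y ξ) p - normalConn g cov ι Y (normalConn g cov ι X ξ) p
    - normalConn g cov ι (VectorField.mlieBracket 𝓘(ℝ, F) X Y) ξ p

variable (F)

/-- `D f = 0`, i.e. `D_X (f ξ) = f (D_X ξ)` for all smooth `X` and all smooth normal `ξ`. -/
def HasParallelF : Prop :=
  ∀ (X : ∀ p : M, TangentSpace 𝓘(ℝ, F) p) (ξ : ∀ p : M, TangentSpace 𝓘(ℝ, E) (ι p)),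
    IsSmoothField X → IsSmoothAlong F ι ξ → IsNormal F g ι ξ →
    ∀ p, normalConn g cov ι X (fOp F g J ι ξ) p = fOp F g J ι (normalConn g cov ι X ξ) p

/-- `(R̄(X,Y)·σ)(Z,U) = R^⊥(X,Y)σ(Z,U) - σ(R(X,Y)Z,U) - σ(Z,R(X,Y)U)` vanishes. -/
def IsSemiparallel : Prop :=
  ∀ X Y Z U : ∀ p : M, TangentSpace 𝓘(ℝ, F) p,
    IsSmoothField X → IsSmoothField Y → IsSmoothField Z → IsSmoothField U →
    ∀ p, normalCurv g cov ι X Y (sff g cov ι Z U) p - sff g cov ι (curv g cov ι X Y Z) U p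
      - sff g cov ι Z (curv g cov ι X Y U) p = 0

/-- All sectional curvatures of the induced metric are equal to `c`, that is
`g(R(X,Y)Y,X) = c (g(X,X) g(Y,Y) - g(X,Y)²)`. -/
def HasConstantCurvature (c : ℝ) : Prop :=
  ∀ X Y : ∀ p : M, TangentSpace 𝓘(ℝ, F) p, IsSmoothField X → IsSmoothField Y →
    ∀ p, metric g ι p (curv g cov ι X Y Y p) (X p) =
      c * (metric g ι p (X p) (X p) * metric g ι p (Y p) (Y p) - metric g ι p (X p) (Y p) ^ 2)

/-- `σ = 0`. -/
def IsTotallyGeodesic : Prop :=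
  ∀ X Y : ∀ p : M, TangentSpace 𝓘(ℝ, F) p, IsSmoothField X → IsSmoothField Y →
    ∀ p, sff g cov ι X Y p = 0

end Metric

end Submfd

end

/-!
Since `M` is totally real, `C(X, Y, Z) = g(σ(X, Y), J Z)` is a totally symmetric cubic form.
Applying `D f = 0` to `ξ = J Y` gives `f² σ(X, Y) = 0`, hence `f σ(X, Y) = 0` because `f` is skew,
so that `σ` takes values in `J(TM)` and is determined by `C`. It also follows that
`D (J Y) = J (∇ Y)`, hence `R^⊥(X, Y) J = J R(X, Y)`, and semiparallelity becomes the invariance of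
`C` under every `R(X, Y)`. If the sectional curvature is a constant `c ≠ 0`, the operators `R(X, Y)`
span the Lie algebra of the rotations of `T_pM`, and as `dim M > 1` an invariant cubic form
vanishes: for orthogonal `X, Y ≠ 0` the invariance gives first `C(Y, Y, X) = 0` and then
`C(X, X, X) = 0`.
-/

noncomputable section

section Commutator

open VectorField Filter
open scoped Topology

variable {F : Type*} [NormedAddCommGroup F] [NormedSpace ℝ F]
  {M : Type*} [TopologicalSpace M] [ChartedSpace F M]
  {G : Type*} [NormedAddCommGroup G] [NormedSpace ℝ G]

lemma mvfderiv_congr_of_eventuallyEq {f h : M → G} {p : M} (hfh : f =ᶠ[𝓝 p] h) :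
    d% f p = d% h p := by
  ext v
  exact congrArg (fun L : F →L[ℝ] G => L v) hfh.mfderiv_eq

lemma fderiv_fderiv_apply_sub {X Y : F → F} {f : F → G} {x : F}
    (hX : DifferentiableAt ℝ X x) (hY : DifferentiableAt ℝ Y x) (hf : ContDiffAt ℝ 2 f x) :
    fderiv ℝ (fun y => fderiv ℝ f y (Y y)) x (X x) - fderiv ℝ (fun y => fderiv ℝ f y (X y)) x (Y x)
      = fderiv ℝ f x (lieBracket ℝ X Y x) := by
  have hf' : DifferentiableAt ℝ (fderiv ℝ f) x :=
    (hf.fderiv_right (m := 1) le_rfl).differentiableAt one_ne_zero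
  have hsymm : fderiv ℝ (fderiv ℝ f) x (X x) (Y x) = fderiv ℝ (fderiv ℝ f) x (Y x) (X x) :=
    hf.isSymmSndFDerivAt (by simp) (X x) (Y x)
  rw [fderiv_clm_apply hf' hY, fderiv_clm_apply hf' hX]
  simp [lieBracket, hsymm]

lemma fderiv_comp_mpullback {ψ : F → M} {f : M → G} {x : F} (hf : MDiffAt f (ψ x))
    (hψ : MDiffAt ψ x) (hψ' : (mfderiv% ψ x).IsInvertible)
    (X : ∀ q : M, TangentSpace 𝓘(ℝ, F) q) :
    fderiv ℝ (f ∘ ψ) x (mpullback 𝓘(ℝ, F) 𝓘(ℝ, F) ψ X x) = d% f (ψ x) (X (ψ x)) := by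
  have hcomp := mfderiv_comp_apply x hf hψ (mpullback 𝓘(ℝ, F) 𝓘(ℝ, F) ψ X x)
  rw [mpullback_apply, hψ'.self_apply_inverse, mfderiv_eq_fderiv] at hcomp
  exact hcomp

variable [IsManifold 𝓘(ℝ, F) ∞ M]

lemma contMDiffAt_mvfderiv_apply {n m : ℕ∞ω} {f : M → G}
    {X : ∀ p : M, TangentSpace 𝓘(ℝ, F) p} {p : M}
    (hf : CMDiffAt n f p) (hX : CMDiffAt m (T% X) p) (hmn : m + 1 ≤ n) :
    CMDiffAt m (fun q => d% f q (X q)) p := by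
  have hdf : CMDiffAt m (fun q => (TotalSpace.mk' G (f q)
      (mfderiv 𝓘(ℝ, F) 𝓘(ℝ, G) f q (X q)) : TangentBundle 𝓘(ℝ, G) G)) p :=
    ContMDiffAt.clm_apply_of_inCoordinates (hf.mfderiv_const hmn) hX
      (hf.of_le (le_self_add.trans hmn))
  exact (contMDiff_snd_tangentBundle_modelSpace (𝕜 := ℝ) G 𝓘(ℝ, G)).contMDiffAt.comp p hdf

lemma mvfderiv_mlieBracket_of_localDiffeo [CompleteSpace F]
    {X Y : ∀ p : M, TangentSpace 𝓘(ℝ, F) p} {f : M → G} {ψ : F → M} {x : F}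
    (hψ : CMDiffAt 2 ψ x) (hψ' : ∀ᶠ y in 𝓝 x, (mfderiv% ψ y).IsInvertible)
    (hX : CMDiffAt 1 (T% X) (ψ x)) (hY : CMDiffAt 1 (T% Y) (ψ x)) (hf : CMDiffAt 2 f (ψ x)) :
    d% f (ψ x) (mlieBracket 𝓘(ℝ, F) X Y (ψ x)) =
      d% (fun q => d% f q (Y q)) (ψ x) (X (ψ x)) -
        d% (fun q => d% f q (X q)) (ψ x) (Y (ψ x)) := by
  have : IsManifold 𝓘(ℝ, F) (minSmoothness ℝ 3) M := by
    rw [minSmoothness_of_isRCLikeNormedField]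
    infer_instance
  have hψ₁ : MDiffAt ψ x := hψ.mdifferentiableAt two_ne_zero
  have pullback_field {Z : ∀ q : M, TangentSpace 𝓘(ℝ, F) q} (hZ : CMDiffAt 1 (T% Z) (ψ x)) :
      DifferentiableAt ℝ (mpullback 𝓘(ℝ, F) 𝓘(ℝ, F) ψ Z) x :=
    (contMDiffAt_vectorSpace_iff_contDiffAt.1 (hZ.mpullback_vectorField_preimage hψ
      hψ'.self_of_nhds (by norm_num))).differentiableAt one_ne_zero
  have pullback_deriv (Z : ∀ q : M, TangentSpace 𝓘(ℝ, F) q) :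
      (fun q => d% f q (Z q)) ∘ ψ =ᶠ[𝓝 x]
        fun y => fderiv ℝ (f ∘ ψ) y (mpullback 𝓘(ℝ, F) 𝓘(ℝ, F) ψ Z y) := by
    filter_upwards [hψ', (contMDiffAt_iff_contMDiffAt_nhds (by simp)).1 hψ,
      hψ.continuousAt.eventually ((contMDiffAt_iff_contMDiffAt_nhds (by simp)).1 hf)]
      with y hy' hy hfy
    exact (fderiv_comp_mpullback (hfy.mdifferentiableAt two_ne_zero)
      (hy.mdifferentiableAt two_ne_zero) hy' Z).symm
  have pullback_deriv_deriv {Z : ∀ q : M, TangentSpace 𝓘(ℝ, F) q} (hZ : CMDiffAt 1 (T% Z) (ψ x))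
      (W : ∀ q : M, TangentSpace 𝓘(ℝ, F) q) :
      d% (fun q => d% f q (Z q)) (ψ x) (W (ψ x)) =
        fderiv ℝ (fun y => fderiv ℝ (f ∘ ψ) y (mpullback 𝓘(ℝ, F) 𝓘(ℝ, F) ψ Z y)) x
          (mpullback 𝓘(ℝ, F) 𝓘(ℝ, F) ψ W x) := by
    rw [← (pullback_deriv Z).fderiv_eq, fderiv_comp_mpullback
      ((contMDiffAt_mvfderiv_apply hf hZ (by norm_num)).mdifferentiableAt one_ne_zero) hψ₁
      hψ'.self_of_nhds]
  rw [pullback_deriv_deriv hY, pullback_deriv_deriv hX, fderiv_fderiv_apply_sub (pullback_field hX)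
      (pullback_field hY) (hf.comp x hψ).contDiffAt,
    ← fderiv_comp_mpullback (hf.mdifferentiableAt two_ne_zero) hψ₁ hψ'.self_of_nhds,
    mpullback_mlieBracket (hX.mdifferentiableAt one_ne_zero) (hY.mdifferentiableAt one_ne_zero) hψ
      (by rw [minSmoothness_of_isRCLikeNormedField])]
  simp only [← mlieBracketWithin_univ, mlieBracketWithin_eq_lieBracketWithin]
  exact congrArg (fun Z : F → F => fderiv ℝ (f ∘ ψ) x (Z x)) lieBracketWithin_univ

lemma mvfderiv_mlieBracket [CompleteSpace F] {X Y : ∀ p : M, TangentSpace 𝓘(ℝ, F) p} {f : M → G}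
    {p : M} (hX : CMDiffAt 1 (T% X) p) (hY : CMDiffAt 1 (T% Y) p) (hf : CMDiffAt 2 f p) :
    d% f p (mlieBracket 𝓘(ℝ, F) X Y p) =
      d% (fun q => d% f q (Y q)) p (X p) - d% (fun q => d% f q (X q)) p (Y p) := by
  let ψ : F → M := (extChartAt 𝓘(ℝ, F) p).symm
  let x : F := extChartAt 𝓘(ℝ, F) p p
  have hψx : ψ x = p := extChartAt_to_inv p
  have hψ : CMDiffAt 2 ψ x := by
    have h := contMDiffWithinAt_extChartAt_symm_range_self (I := 𝓘(ℝ, F)) (n := 2) p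
    rwa [modelWithCornersSelf_coe, Set.range_id, contMDiffWithinAt_univ] at h
  have hψ' : ∀ᶠ y in 𝓝 x, (mfderiv% ψ y).IsInvertible := by
    filter_upwards [extChartAt_target_mem_nhds (I := 𝓘(ℝ, F)) p] with y hy
    have h := isInvertible_mfderivWithin_extChartAt_symm hy
    rwa [modelWithCornersSelf_coe, Set.range_id, mfderivWithin_univ] at h
  rw [← hψx] at hX hY hf ⊢
  exact mvfderiv_mlieBracket_of_localDiffeo hψ hψ' hX hY hf

end Commutator

section FiniteDimensional

variable {F : Type*} [NormedAddCommGroup F] [NormedSpace ℝ F]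
  {M : Type*} [TopologicalSpace M] [ChartedSpace F M]
  {V : Type*} [NormedAddCommGroup V] [NormedSpace ℝ V] [FiniteDimensional ℝ V]
  {W : Type*} [NormedAddCommGroup W] [NormedSpace ℝ W]

lemma contMDiffAt_clm_of_apply {n : ℕ∞ω} {G : M → V →L[ℝ] W} {p : M}
    (h : ∀ v, CMDiffAt n (fun q => G q v) p) : CMDiffAt n G p := by
  let e := (ContinuousLinearEquiv.ofFinrankEq
    (Module.finrank_fin_fun (n := Module.finrank ℝ V) ℝ).symm).arrowCongr
      (ContinuousLinearEquiv.refl ℝ W) |>.trans (ContinuousLinearEquiv.piRing (𝕜 := ℝ) (Fin _))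
  have he : ContMDiffAt 𝓘(ℝ, F) 𝓘(ℝ, Fin _ → W) n (fun q => e (G q)) p :=
    contMDiffAt_pi_space.2 fun i => h _
  simpa only [Function.comp_def, ContinuousLinearEquiv.symm_apply_apply] using
    e.symm.contDiff.contMDiff.contMDiffAt.comp p he

lemma isInvertible_of_apply_self_ne_zero {B : V →L[ℝ] V →L[ℝ] ℝ} (h : ∀ v, B v v = 0 → v = 0) :
    B.IsInvertible := by
  have hinj : Function.Injective B.toLinearMap := by
    refine (injective_iff_map_eq_zero _).2 fun v hv => h v ?_
    exact (DFunLike.congr_fun hv v).trans rfl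
  have hfinrank : Module.finrank ℝ V = Module.finrank ℝ (V →L[ℝ] ℝ) := by
    rw [← (LinearMap.toContinuousLinearMap (𝕜 := ℝ) (E := V) (F' := ℝ)).finrank_eq]
    exact Subspace.dual_finrank_eq.symm
  exact ⟨(LinearEquiv.ofInjectiveOfFinrankEq _ hinj hfinrank).toContinuousLinearEquiv, rfl⟩

end FiniteDimensional

section CurvatureLike

variable {V : Type*} [AddCommGroup V] {K K' : V → V → V → V → ℝ}

/-- A quadriadditive form `K x y z w` with the algebraic symmetries of a curvature tensor
`g(R(x, y)z, w)`. The symmetries turn additivity in the last argument into additivity in the others,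
so only the former is a field. -/
structure IsCurvatureLike (K : V → V → V → V → ℝ) : Prop where
  antisymm_left : ∀ x y z w, K x y z w = -K y x z w
  antisymm_right : ∀ x y z w, K x y z w = -K x y w z
  bianchi : ∀ x y z w, K x y z w + K y z x w + K z x y w = 0
  add_right : ∀ x y z w w', K x y z (w + w') = K x y z w + K x y z w'

namespace IsCurvatureLike

lemma sub (hK : IsCurvatureLike K) (hK' : IsCurvatureLike K') :
    IsCurvatureLike (fun x y z w => K x y z w - K' x y z w) where
  antisymm_left x y z w := by
    linarith [hK.antisymm_left x y z w, hK'.antisymm_left x y z w]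
  antisymm_right x y z w := by
    linarith [hK.antisymm_right x y z w, hK'.antisymm_right x y z w]
  bianchi x y z w := by
    linarith [hK.bianchi x y z w, hK'.bianchi x y z w]
  add_right x y z w w' := by
    rw [hK.add_right, hK'.add_right]
    ring

lemma of_symm {B : V → V → ℝ} (hB : ∀ x y, B x y = B y x)
    (hadd : ∀ x y y', B x (y + y') = B x y + B x y') (c : ℝ) :
    IsCurvatureLike (fun x y z w => c * (B y z * B x w - B x z * B y w)) where
  antisymm_left x y z w := by ring
  antisymm_right x y z w := by ring
  bianchi x y z w := by
    rw [hB y x, hB z x, hB z y]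
    ring
  add_right x y z w w' := by
    rw [hadd, hadd]
    ring

lemma pair_symm (hK : IsCurvatureLike K) (x y z w : V) : K x y z w = K z w x y := by
  have hb := hK.bianchi
  have hl := hK.antisymm_left
  have hr := hK.antisymm_right
  linarith [hb x y z w, hb y z w x, hb z w x y, hb w x y z, hr y z x w, hl z x y w, hr x z y w,
    hl w y z x, hr y w z x, hr w x z y, hr x y z w, hr z w x y]

lemma add_third (hK : IsCurvatureLike K) (x y z z' w : V) :
    K x y (z + z') w = K x y z w + K x y z' w := by
  rw [hK.antisymm_right, hK.add_right, hK.antisymm_right x y z, hK.antisymm_right x y z', neg_add]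

lemma add_second (hK : IsCurvatureLike K) (x y y' z w : V) :
    K x (y + y') z w = K x y z w + K x y' z w := by
  rw [hK.pair_symm, hK.add_right, hK.pair_symm z w x y, hK.pair_symm z w x y']

lemma add_left (hK : IsCurvatureLike K) (x x' y z w : V) :
    K (x + x') y z w = K x y z w + K x' y z w := by
  rw [hK.pair_symm, hK.add_third, hK.pair_symm z w x y, hK.pair_symm z w x' y]

lemma apply_self_middle_eq_zero (hK : IsCurvatureLike K) (hsec : ∀ x y, K x y y x = 0)
    (x y z : V) : K x y y z = 0 := by
  have hpolar := hsec (x + z) y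
  rw [hK.add_left, hK.add_right, hK.add_right, hsec, hsec] at hpolar
  have hsymm : K z y y x = K x y y z := by
    rw [hK.pair_symm, hK.antisymm_left, hK.antisymm_right, neg_neg]
  linarith

/- Polarizing twice makes `K` alternating in its first three arguments, so that the three terms of
the Bianchi identity coincide. -/
lemma eq_zero_of_sectional (hK : IsCurvatureLike K) (hsec : ∀ x y, K x y y x = 0) (x y z w : V) :
    K x y z w = 0 := by
  have hswap : ∀ x y z w, K x y z w = -K x z y w := fun x y z w => by
    have hpolar := hK.apply_self_middle_eq_zero hsec x (y + z) w
    rw [hK.add_second, hK.add_third, hK.add_third, hK.apply_self_middle_eq_zero hsec,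
      hK.apply_self_middle_eq_zero hsec] at hpolar
    linarith
  have hcycle : ∀ x y z w, K y z x w = K x y z w := fun x y z w => by
    rw [hswap, hK.antisymm_left, neg_neg]
  have hbianchi := hK.bianchi x y z w
  rw [hcycle y z x, hcycle x y z] at hbianchi
  linarith

lemma eq_of_sectional (hK : IsCurvatureLike K) (hK' : IsCurvatureLike K')
    (hsec : ∀ x y, K x y y x = K' x y y x) (x y z w : V) : K x y z w = K' x y z w :=
  sub_eq_zero.1 <| (hK.sub hK').eq_zero_of_sectional (fun x y => sub_eq_zero.2 (hsec x y)) x y z w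

end IsCurvatureLike

end CurvatureLike

section Trilinear

lemma trilinear_eq_zero {V : Type*} [AddCommGroup V] {T : V → V → V → ℝ}
    (h₁₂ : ∀ x y z, T x y z = T y x z) (h₂₃ : ∀ x y z, T x y z = T x z y)
    (hadd : ∀ x y z z', T x y (z + z') = T x y z + T x y z') (hdiag : ∀ x, T x x x = 0)
    (x y z : V) : T x y z = 0 := by
  have hadd₂ : ∀ x y y' z, T x (y + y') z = T x y z + T x y' z := fun x y y' z => by
    rw [h₂₃, hadd, h₂₃ x z y, h₂₃ x z y']
  have hadd₁ : ∀ x x' y z, T (x + x') y z = T x y z + T x' y z := fun x x' y z => by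
    rw [h₁₂, hadd₂, h₁₂ y x z, h₁₂ y x' z]
  have hpolar : ∀ x y, T x x y + T x y y = 0 := fun x y => by
    have h := hdiag (x + y)
    simp only [hadd₁, hadd₂, hadd, hdiag] at h
    linarith [h₂₃ x x y, h₁₂ x y x, h₁₂ x y y, h₂₃ y x y]
  have hquadratic : ∀ x y, T x y y = 0 := fun x y => by
    have h := hpolar x (y + y)
    simp only [hadd₂, hadd] at h
    linarith [hpolar x y]
  have h := hquadratic x (y + z)
  simp only [hadd₂, hadd, hquadratic] at h
  linarith [h₂₃ x y z]

end Trilinear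

section Kaehler

variable {E : Type*} [NormedAddCommGroup E] [NormedSpace ℝ E] [FiniteDimensional ℝ E]
  {N : Type*} [TopologicalSpace N] [ChartedSpace E N] [IsManifold 𝓘(ℝ, E) ∞ N]
  {g : ContMDiffRiemannianMetric 𝓘(ℝ, E) ∞ E (fun x : N => TangentSpace 𝓘(ℝ, E) x)}
  {cov : CovariantDerivative 𝓘(ℝ, E) E (fun x : N => TangentSpace 𝓘(ℝ, E) x)}
  {J : ∀ x : N, TangentSpace 𝓘(ℝ, E) x →L[ℝ] TangentSpace 𝓘(ℝ, E) x}

lemma IsKaehler.inner_J_left (hK : IsKaehler g cov J) {x : N} (v w : TangentSpace 𝓘(ℝ, E) x) :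
    g.inner x (J x v) w = -g.inner x v (J x w) := by
  rw [← hK.J_isometry x v, hK.J_sq, map_neg, neg_neg]

end Kaehler

namespace Submfd

open Filter
open scoped Topology

section Coordinates

variable {E : Type*} [NormedAddCommGroup E] [NormedSpace ℝ E]
  {N : Type*} [TopologicalSpace N] [ChartedSpace E N] [IsManifold 𝓘(ℝ, E) ∞ N] {x y : N}

/-- The coordinates of a tangent vector at `y` in the preferred chart at `x`; they are `0` when `y`
lies outside the domain of that chart. -/
def coord (x y : N) : TangentSpace 𝓘(ℝ, E) y →L[ℝ] E :=
  (trivializationAt E (fun x : N => TangentSpace 𝓘(ℝ, E) x) x).continuousLinearMapAt ℝ y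

/-- The tangent vector at `y` with given coordinates in the preferred chart at `x`, the inverse of
`coord x y`; it is `0` when `y` lies outside the domain of that chart. -/
def uncoord (x y : N) : E →L[ℝ] TangentSpace 𝓘(ℝ, E) y :=
  (trivializationAt E (fun x : N => TangentSpace 𝓘(ℝ, E) x) x).symmL ℝ y

lemma coord_eq_trivializationAt (hy : y ∈ (chartAt E x).source) (v : TangentSpace 𝓘(ℝ, E) y) :
    coord x y v = (trivializationAt E (fun x : N => TangentSpace 𝓘(ℝ, E) x) x ⟨y, v⟩).2 :=
  (trivializationAt E (fun x : N => TangentSpace 𝓘(ℝ, E) x)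
    x).continuousLinearMapAt_apply_of_mem (R := ℝ) hy v

lemma uncoord_eq_symm (hy : y ∈ (chartAt E x).source) (v : E) :
    uncoord x y v = (trivializationAt E (fun x : N => TangentSpace 𝓘(ℝ, E) x) x).symm y v :=
  Trivialization.symmL_apply _ hy v

lemma uncoord_coord (hy : y ∈ (chartAt E x).source) (v : TangentSpace 𝓘(ℝ, E) y) :
    uncoord x y (coord x y v) = v :=
  Trivialization.symmL_continuousLinearMapAt _ hy v

lemma coord_uncoord (hy : y ∈ (chartAt E x).source) (v : E) : coord x y (uncoord x y v) = v :=
  Trivialization.continuousLinearMapAt_symmL _ hy v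

lemma extend_eq_uncoord_coord (hy : y ∈ (chartAt E x).source)
    (v : TangentSpace 𝓘(ℝ, E) x) : FiberBundle.extend E v y = uncoord x y (coord x x v) := by
  rw [coord_eq_trivializationAt (mem_chart_source E x), uncoord_eq_symm hy]
  rfl

lemma contMDiffOn_uncoord (x : N) (v : E) :
    CMDiff[(chartAt E x).source] ∞ (T% fun y : N => uncoord x y v) := by
  let e := trivializationAt E (fun x : N => TangentSpace 𝓘(ℝ, E) x) x
  have h : CMDiff[e.baseSet] ∞ (fun y : N => e.toPartialHomeomorph.symm (y, v)) :=
    e.contMDiffOn_symm.comp (contMDiffOn_id.prodMk contMDiffOn_const)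
      fun y hy => (e.mem_target).2 hy
  refine h.congr fun y hy => ?_
  rw [uncoord_eq_symm hy]
  exact e.mk_symm hy v

variable {F : Type*} [NormedAddCommGroup F] [NormedSpace ℝ F]
  {M : Type*} [TopologicalSpace M] [ChartedSpace F M]
  {ι : M → N} {s : ∀ p : M, TangentSpace 𝓘(ℝ, E) (ι p)} {p : M}

lemma contMDiffAt_along_iff_coord (hp : ι p ∈ (chartAt E x).source) :
    CMDiffAt ∞ (fun q => (⟨ι q, s q⟩ : TangentBundle 𝓘(ℝ, E) N)) p ↔
      CMDiffAt ∞ ι p ∧ CMDiffAt ∞ (fun q => coord x (ι q) (s q)) p := by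
  let e := trivializationAt E (fun x : N => TangentSpace 𝓘(ℝ, E) x) x
  rw [e.contMDiffAt_iff (f := fun q => (⟨ι q, s q⟩ : TangentBundle 𝓘(ℝ, E) N))
    (e.mem_source.2 hp)]
  refine and_congr_right fun hι => Filter.EventuallyEq.contMDiffAt_iff ?_
  filter_upwards [hι.continuousAt.eventually ((chartAt E x).open_source.mem_nhds hp)] with q hq
  exact (coord_eq_trivializationAt hq _).symm

lemma IsSmoothAlong.contMDiff (hs : IsSmoothAlong F ι s) : CMDiff ∞ ι :=
  fun p => ((contMDiffAt_along_iff_coord (mem_chart_source E (ι p))).1 (hs p)).1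

lemma IsSmoothAlong.coord (hs : IsSmoothAlong F ι s) (hp : ι p ∈ (chartAt E x).source) :
    CMDiffAt ∞ (fun q => coord x (ι q) (s q)) p :=
  ((contMDiffAt_along_iff_coord hp).1 (hs p)).2

end Coordinates

section Along

variable {F : Type*} [NormedAddCommGroup F] [NormedSpace ℝ F]
  {M : Type*} [TopologicalSpace M] [ChartedSpace F M]
  {E : Type*} [NormedAddCommGroup E] [NormedSpace ℝ E]
  {N : Type*} [TopologicalSpace N] [ChartedSpace E N] [IsManifold 𝓘(ℝ, E) ∞ N]
  {ι : M → N} {s t : ∀ p : M, TangentSpace 𝓘(ℝ, E) (ι p)}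

lemma contMDiffAt_along_add {p : M}
    (hs : CMDiffAt ∞ (fun q => (⟨ι q, s q⟩ : TangentBundle 𝓘(ℝ, E) N)) p)
    (ht : CMDiffAt ∞ (fun q => (⟨ι q, t q⟩ : TangentBundle 𝓘(ℝ, E) N)) p) :
    CMDiffAt ∞ (fun q => (⟨ι q, s q + t q⟩ : TangentBundle 𝓘(ℝ, E) N)) p := by
  rw [contMDiffAt_along_iff_coord (mem_chart_source E (ι p))] at hs ht ⊢
  simpa only [map_add] using! And.intro hs.1 (hs.2.add ht.2)

lemma contMDiffAt_along_smul {a : M → ℝ} {p : M} (ha : CMDiffAt ∞ a p)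
    (hs : CMDiffAt ∞ (fun q => (⟨ι q, s q⟩ : TangentBundle 𝓘(ℝ, E) N)) p) :
    CMDiffAt ∞ (fun q => (⟨ι q, a q • s q⟩ : TangentBundle 𝓘(ℝ, E) N)) p := by
  rw [contMDiffAt_along_iff_coord (mem_chart_source E (ι p))] at hs ⊢
  simpa only [map_smul] using! And.intro hs.1 (ha.smul hs.2)

lemma IsSmoothAlong.add (hs : IsSmoothAlong F ι s) (ht : IsSmoothAlong F ι t) :
    IsSmoothAlong F ι (fun q => s q + t q) :=
  fun p => contMDiffAt_along_add (hs p) (ht p)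

lemma IsSmoothAlong.smul {a : M → ℝ} (ha : CMDiff ∞ a) (hs : IsSmoothAlong F ι s) :
    IsSmoothAlong F ι (fun q => a q • s q) :=
  fun p => contMDiffAt_along_smul (ha p) (hs p)

lemma IsSmoothAlong.neg (hs : IsSmoothAlong F ι s) : IsSmoothAlong F ι (fun q => - s q) := by
  simpa only [neg_smul, one_smul] using hs.smul (contMDiff_const (c := (-1 : ℝ)))

lemma IsSmoothAlong.sub (hs : IsSmoothAlong F ι s) (ht : IsSmoothAlong F ι t) :
    IsSmoothAlong F ι (fun q => s q - t q) := by
  simpa only [sub_eq_add_neg] using hs.add ht.neg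

lemma IsSmoothField.along {Y : ∀ x : N, TangentSpace 𝓘(ℝ, E) x} (hY : IsSmoothField Y)
    (hι : CMDiff ∞ ι) : IsSmoothAlong F ι (fun q => Y (ι q)) :=
  ContMDiff.comp hY hι

variable [FiniteDimensional ℝ E] [T2Space N]

lemma isSmoothField_bump_smul_uncoord {x : N} (ψ : SmoothBumpFunction 𝓘(ℝ, E) x) (v : E) :
    IsSmoothField (fun y : N => ψ y • uncoord x y v) :=
  ContMDiffOn.smul_section_of_tsupport ψ.contMDiff.contMDiffOn (chartAt E x).open_source
    ψ.tsupport_subset_chartAt_source (contMDiffOn_uncoord x v)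

lemma IsSmoothAlong.contMDiff_bump_smul_coord {x : N} (ψ : SmoothBumpFunction 𝓘(ℝ, E) x)
    (hs : IsSmoothAlong F ι s) : CMDiff ∞ (fun q => ψ (ι q) • Submfd.coord x (ι q) (s q)) := by
  have hι := hs.contMDiff
  refine contMDiff_of_tsupport fun q hq => ?_
  have hq' : ι q ∈ tsupport ψ := tsupport_comp_subset_preimage ψ hι.continuous
    (tsupport_smul_subset_left (ψ ∘ ι) (fun q => Submfd.coord x (ι q) (s q)) hq)
  exact (ψ.contMDiff.comp hι q).smul (hs.coord (ψ.tsupport_subset_chartAt_source hq'))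

lemma exists_isSmoothField_eq (x : N) (v : TangentSpace 𝓘(ℝ, E) x) :
    ∃ Y : ∀ y : N, TangentSpace 𝓘(ℝ, E) y, IsSmoothField Y ∧ Y x = v := by
  let ψ : SmoothBumpFunction 𝓘(ℝ, E) x := Classical.arbitrary _
  refine ⟨_, isSmoothField_bump_smul_uncoord ψ (coord x x v), ?_⟩
  rw [ψ.eq_one, one_smul, uncoord_coord (mem_chart_source E x)]

/- The last case suffices because near `p` a field along `ι` is a combination, with smooth
coefficients on `M`, of the coordinate fields of `N` around `ι p`, cut off by a bump function. -/
@[elab_as_elim]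
lemma IsSmoothAlong.induction (p : M)
    {P : ∀ s : ∀ p : M, TangentSpace 𝓘(ℝ, E) (ι p), IsSmoothAlong F ι s → Prop}
    (congr : ∀ s t hs ht, (∀ᶠ q in 𝓝 p, s q = t q) → P s hs → P t ht)
    (add : ∀ s t hs ht, P s hs → P t ht → P (fun q => s q + t q) (hs.add ht))
    (smul : ∀ (a : M → ℝ) s ha hs, P s hs → P (fun q => a q • s q) (hs.smul ha))
    (comp : ∀ (Y : ∀ x : N, TangentSpace 𝓘(ℝ, E) x) (hY : IsSmoothField Y) (hι : CMDiff ∞ ι),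
      P (fun q => Y (ι q)) (hY.along hι))
    {s : ∀ p : M, TangentSpace 𝓘(ℝ, E) (ι p)} (hs : IsSmoothAlong F ι s) : P s hs := by
  let b := Module.finBasis ℝ E
  let ψ : SmoothBumpFunction 𝓘(ℝ, E) (ι p) := Classical.arbitrary _
  let a (i) (q : M) : ℝ := b.equivFunL (ψ (ι q) • Submfd.coord (ι p) (ι q) (s q)) i
  let e (i) (y : N) : TangentSpace 𝓘(ℝ, E) y := ψ y • uncoord (ι p) y (b i)
  have ha (i) : CMDiff ∞ (a i) :=
    ((ContinuousLinearMap.proj i).comp b.equivFunL.toContinuousLinearMap).contMDiff.comp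
      (hs.contMDiff_bump_smul_coord ψ)
  have he (i) : IsSmoothField (e i) := isSmoothField_bump_smul_uncoord ψ (b i)
  have hsum (T) : ∃ h, P (fun q => ∑ i ∈ T, a i q • e i (ι q)) h := by
    induction T using Finset.induction_on with
    | empty =>
      have h0 : IsSmoothField (fun x : N => (0 : TangentSpace 𝓘(ℝ, E) x)) :=
        contMDiff_zeroSection ℝ _
      simpa only [Finset.sum_empty] using
        Exists.intro (h0.along hs.contMDiff) (comp _ h0 hs.contMDiff)
    | insert i T hi ih =>
      obtain ⟨hT, ihT⟩ := ih
      have hei : IsSmoothAlong F ι (fun q => e i (ι q)) := (he i).along hs.contMDiff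
      simpa only [Finset.sum_insert hi] using Exists.intro ((hei.smul (ha i)).add hT)
        (add _ _ (hei.smul (ha i)) hT (smul _ _ (ha i) hei (comp _ (he i) hs.contMDiff)) ihT)
  refine congr _ s _ hs ?_ (hsum Finset.univ).choose_spec
  filter_upwards [(hs.contMDiff p).continuousAt.eventually (ψ.eventuallyEq_one.and
    (chart_source_mem_nhds E (ι p)))] with q ⟨hψ, hq⟩
  calc ∑ i, a i q • e i (ι q)
      = uncoord (ι p) (ι q) (∑ i, b.repr (Submfd.coord (ι p) (ι q) (s q)) i • b i) := by
        simp only [a, e, hψ, one_smul, map_sum, map_smul, Pi.one_apply,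
          Module.Basis.equivFunL_apply]
    _ = s q := by rw [b.sum_repr, uncoord_coord hq]

end Along

section CovAlong

variable {F : Type*} [NormedAddCommGroup F] [NormedSpace ℝ F]
  {M : Type*} [TopologicalSpace M] [ChartedSpace F M]
  {E : Type*} [NormedAddCommGroup E] [NormedSpace ℝ E]
  {N : Type*} [TopologicalSpace N] [ChartedSpace E N] [IsManifold 𝓘(ℝ, E) ∞ N]
  {cov : CovariantDerivative 𝓘(ℝ, E) E (fun x : N => TangentSpace 𝓘(ℝ, E) x)}
  {ι : M → N} {s t : ∀ p : M, TangentSpace 𝓘(ℝ, E) (ι p)} {p : M}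

lemma mdifferentiableAt_along_iff_coord :
    MDiffAt (fun q => (⟨ι q, s q⟩ : TangentBundle 𝓘(ℝ, E) N)) p ↔
      MDiffAt ι p ∧ MDiffAt (fun q => coord (ι p) (ι q) (s q)) p := by
  rw [mdifferentiableAt_totalSpace]
  refine and_congr_right fun hι => Filter.EventuallyEq.mdifferentiableAt_iff ?_
  filter_upwards [hι.continuousAt.eventually (chart_source_mem_nhds E (ι p))] with q hq
  exact (coord_eq_trivializationAt hq _).symm

lemma IsSmoothAlong.mdifferentiableAt (hs : IsSmoothAlong F ι s) (p : M) :
    MDiffAt (fun q => (⟨ι q, s q⟩ : TangentBundle 𝓘(ℝ, E) N)) p :=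
  (hs p).mdifferentiableAt (by simp)

lemma covAlong_eq_coord (hι : ContinuousAt ι p) (v : TangentSpace 𝓘(ℝ, F) p) :
    covAlong cov ι s p v =
      uncoord (ι p) (ι p) (d% (fun q => coord (ι p) (ι q) (s q)) p v)
        + cov (FiberBundle.extend E (s p)) (ι p) (dι F E ι p v) := by
  have hcoord : (fun q => coord (ι p) (ι q) (s q)) =ᶠ[𝓝 p] fun q =>
      (trivializationAt E (fun x : N => TangentSpace 𝓘(ℝ, E) x) (ι p) ⟨ι q, s q⟩).2 := by
    filter_upwards [hι.eventually (chart_source_mem_nhds E (ι p))] with q hq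
    exact coord_eq_trivializationAt hq _
  rw [uncoord_eq_symm (mem_chart_source E _), mvfderiv_congr_of_eventuallyEq hcoord]
  rfl

lemma covAlong_congr_of_eventuallyEq (h : ∀ᶠ q in 𝓝 p, s q = t q) :
    covAlong (F := F) cov ι s p = covAlong cov ι t p := by
  have htriv : (fun q =>
      (trivializationAt E (fun x : N => TangentSpace 𝓘(ℝ, E) x) (ι p) ⟨ι q, s q⟩).2) =ᶠ[𝓝 p]
        fun q => (trivializationAt E (fun x : N => TangentSpace 𝓘(ℝ, E) x) (ι p) ⟨ι q, t q⟩).2 := by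
    filter_upwards [h] with q hq
    rw [hq]
  funext v
  simp only [covAlong, htriv.mfderiv_eq, h.self_of_nhds]
  rfl

lemma cov_extend_add {x : N} (v w : TangentSpace 𝓘(ℝ, E) x) :
    cov (FiberBundle.extend E (v + w)) x =
      cov (FiberBundle.extend E v) x + cov (FiberBundle.extend E w) x := by
  have hv := FiberBundle.mdifferentiableAt_extend 𝓘(ℝ, E) E v
  have hw := FiberBundle.mdifferentiableAt_extend 𝓘(ℝ, E) E w
  rw [← cov.isCovariantDerivativeOnUniv.add hv hw]
  refine cov.isCovariantDerivativeOnUniv.congr_of_eventuallyEq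
    (FiberBundle.mdifferentiableAt_extend ..) (mdifferentiableAt_add_section hv hw) univ_mem ?_
  filter_upwards [chart_source_mem_nhds E x] with y hy
  simp only [Pi.add_apply, extend_eq_uncoord_coord hy, map_add]

lemma cov_extend_smul {x : N} (a : ℝ) (v : TangentSpace 𝓘(ℝ, E) x) :
    cov (FiberBundle.extend E (a • v)) x = a • cov (FiberBundle.extend E v) x := by
  have hv := FiberBundle.mdifferentiableAt_extend 𝓘(ℝ, E) E v
  rw [← cov.isCovariantDerivativeOnUniv.smul_const a hv]
  refine cov.isCovariantDerivativeOnUniv.congr_of_eventuallyEq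
    (FiberBundle.mdifferentiableAt_extend ..) (mdifferentiableAt_const.smul_section hv) univ_mem ?_
  filter_upwards [chart_source_mem_nhds E x] with y hy
  simp only [Pi.smul_apply, extend_eq_uncoord_coord hy, map_smul]

lemma covAlong_add (hs : MDiffAt (fun q => (⟨ι q, s q⟩ : TangentBundle 𝓘(ℝ, E) N)) p)
    (ht : MDiffAt (fun q => (⟨ι q, t q⟩ : TangentBundle 𝓘(ℝ, E) N)) p)
    (v : TangentSpace 𝓘(ℝ, F) p) :
    covAlong cov ι (fun q => s q + t q) p v = covAlong cov ι s p v + covAlong cov ι t p v := by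
  rw [mdifferentiableAt_along_iff_coord] at hs ht
  have hι := hs.1.continuousAt
  simp only [covAlong_eq_coord hι, map_add, mvfderiv_fun_add hs.2 ht.2, add_apply, cov_extend_add]
  abel

lemma covAlong_smul {a : M → ℝ} (ha : MDiffAt a p)
    (hs : MDiffAt (fun q => (⟨ι q, s q⟩ : TangentBundle 𝓘(ℝ, E) N)) p)
    (v : TangentSpace 𝓘(ℝ, F) p) :
    covAlong cov ι (fun q => a q • s q) p v = d% a p v • s p + a p • covAlong cov ι s p v := by
  rw [mdifferentiableAt_along_iff_coord] at hs
  have hι := hs.1.continuousAt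
  simp only [covAlong_eq_coord hι, map_smul, mvfderiv_fun_smul ha hs.2, cov_extend_smul, add_apply,
    map_add, smul_apply, ContinuousLinearMap.smulRight_apply,
    uncoord_coord (mem_chart_source E (ι p)), smul_add]
  abel

lemma covAlong_zero (hι : ContinuousAt ι p) (v : TangentSpace 𝓘(ℝ, F) p) :
    covAlong cov ι (fun _ => 0) p v = 0 := by
  have hextend := cov_extend_smul (cov := cov) 0 (0 : TangentSpace 𝓘(ℝ, E) (ι p))
  rw [zero_smul, zero_smul] at hextend
  simp [covAlong_eq_coord hι, hextend, mvfderiv_const]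

lemma covAlong_id_eq_coord {Y : ∀ x : N, TangentSpace 𝓘(ℝ, E) x} {x : N}
    (w : TangentSpace 𝓘(ℝ, E) x) :
    covAlong cov (fun y => y) Y x w =
      uncoord x x (d% (fun y => coord x y (Y y)) x w) + cov (FiberBundle.extend E (Y x)) x w := by
  have hdι : dι E E (fun y : N => y) x w = w := DFunLike.congr_fun mfderiv_id w
  rw [covAlong_eq_coord continuous_id'.continuousAt, hdι]

lemma covAlong_extend (x : N) (u v : TangentSpace 𝓘(ℝ, E) x) :
    covAlong cov (fun y => y) (FiberBundle.extend E u) x v = cov (FiberBundle.extend E u) x v := by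
  have hconst : (fun y => coord x y (FiberBundle.extend E u y)) =ᶠ[𝓝 x] fun _ => coord x x u := by
    filter_upwards [chart_source_mem_nhds E x] with y hy
    rw [extend_eq_uncoord_coord hy, coord_uncoord hy]
  rw [covAlong_id_eq_coord, mvfderiv_congr_of_eventuallyEq hconst, mvfderiv_const,
    FiberBundle.extend_apply_self, zero_apply, map_zero, zero_add]

variable [FiniteDimensional ℝ E]

lemma covAlong_id {Y : ∀ x : N, TangentSpace 𝓘(ℝ, E) x} {x : N} (hY : MDiffAt (T% Y) x)
    (w : TangentSpace 𝓘(ℝ, E) x) : covAlong cov (fun y => y) Y x w = cov Y x w := by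
  have hΦ : TensorialAt 𝓘(ℝ, E) E (fun Z : ∀ x : N, TangentSpace 𝓘(ℝ, E) x =>
      covAlong cov (fun y => y) Z x w - cov Z x w) x := by
    constructor
    · intro f Z hf hZ
      rw [cov.isCovariantDerivativeOnUniv.leibniz hZ hf]
      refine (congrArg (· - _) (covAlong_smul hf hZ w)).trans ?_
      simp only [add_apply, smul_apply, ContinuousLinearMap.smulRight_apply, smul_sub]
      abel
    · intro Z Z' hZ hZ'
      rw [cov.isCovariantDerivativeOnUniv.add hZ hZ']
      refine (congrArg (· - _) (covAlong_add hZ hZ' w)).trans ?_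
      simp only [add_apply]
      abel
  have h := hΦ.pointwise hY (FiberBundle.mdifferentiableAt_extend 𝓘(ℝ, E) E (Y x))
    (FiberBundle.extend_apply_self E (Y x)).symm
  rwa [covAlong_extend, sub_self, sub_eq_zero] at h

lemma covAlong_comp {Y : ∀ x : N, TangentSpace 𝓘(ℝ, E) x} (hY : MDiffAt (T% Y) (ι p))
    (hι : MDiffAt ι p) (v : TangentSpace 𝓘(ℝ, F) p) :
    covAlong cov ι (fun q => Y (ι q)) p v = cov Y (ι p) (dι F E ι p v) := by
  have hchain := mfderiv_comp_apply p
    (mdifferentiableAt_along_iff_coord (ι := fun y : N => y).1 hY).2 hι v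
  rw [← covAlong_id hY, covAlong_eq_coord hι.continuousAt, covAlong_id_eq_coord]
  exact congrArg (uncoord (ι p) (ι p) · + _) hchain

end CovAlong

section LeviCivita

variable {F : Type*} [NormedAddCommGroup F] [NormedSpace ℝ F]
  {M : Type*} [TopologicalSpace M] [ChartedSpace F M]
  {E : Type*} [NormedAddCommGroup E] [NormedSpace ℝ E]
  {N : Type*} [TopologicalSpace N] [ChartedSpace E N] [IsManifold 𝓘(ℝ, E) ∞ N]
  {g : ContMDiffRiemannianMetric 𝓘(ℝ, E) ∞ E (fun x : N => TangentSpace 𝓘(ℝ, E) x)}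
  {cov : CovariantDerivative 𝓘(ℝ, E) E (fun x : N => TangentSpace 𝓘(ℝ, E) x)}
  {J : ∀ x : N, TangentSpace 𝓘(ℝ, E) x →L[ℝ] TangentSpace 𝓘(ℝ, E) x}
  {ι : M → N} {s t : ∀ p : M, TangentSpace 𝓘(ℝ, E) (ι p)}

lemma contMDiffAt_inner_along {p : M}
    (hs : CMDiffAt ∞ (fun q => (⟨ι q, s q⟩ : TangentBundle 𝓘(ℝ, E) N)) p)
    (ht : CMDiffAt ∞ (fun q => (⟨ι q, t q⟩ : TangentBundle 𝓘(ℝ, E) N)) p) :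
    CMDiffAt ∞ (fun q => g.inner (ι q) (s q) (t q)) p := by
  have hι : CMDiffAt ∞ ι p :=
    ((contMDiffAt_along_iff_coord (mem_chart_source E (ι p))).1 hs).1
  exact (contMDiffAt_totalSpace.1 (ContMDiffAt.clm_bundle_apply₂ (F₁ := E) (F₂ := E) (F₃ := ℝ)
    (E₃ := Bundle.Trivial N ℝ) ((g.contMDiff (ι p)).comp p hι) hs ht)).2

lemma IsSmoothAlong.inner (hs : IsSmoothAlong F ι s) (ht : IsSmoothAlong F ι t) :
    CMDiff ∞ (fun q => g.inner (ι q) (s q) (t q)) :=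
  fun p => contMDiffAt_inner_along (hs p) (ht p)

lemma IsSmoothAlong.apply_J (hs : IsSmoothAlong F ι s)
    (hJ : ContMDiff 𝓘(ℝ, E) (𝓘(ℝ, E).prod 𝓘(ℝ, E →L[ℝ] E)) ∞
      (fun x : N => TotalSpace.mk' (E →L[ℝ] E)
        (E := fun x : N => TangentSpace 𝓘(ℝ, E) x →L[ℝ] TangentSpace 𝓘(ℝ, E) x) x (J x))) :
    IsSmoothAlong F ι (fun q => J (ι q) (s q)) :=
  ContMDiff.clm_bundle_apply (F₁ := E) (F₂ := E) (hJ.comp hs.contMDiff) hs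

lemma IsSmoothField.dι [IsManifold 𝓘(ℝ, F) ∞ M] {X : ∀ p : M, TangentSpace 𝓘(ℝ, F) p}
    (hX : IsSmoothField X) (hι : CMDiff ∞ ι) :
    IsSmoothAlong F ι (fun q => Submfd.dι F E ι q (X q)) :=
  (hι.contMDiff_tangentMap (m := ∞) (by simp)).comp hX

variable {p : M}

section Induction

variable [FiniteDimensional ℝ E]

lemma mvfderiv_inner_comp (hLC : IsLeviCivita g cov) {Y Z : ∀ x : N, TangentSpace 𝓘(ℝ, E) x}
    (hY : IsSmoothField Y) (hZ : IsSmoothField Z) (hι : MDiffAt ι p)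
    (v : TangentSpace 𝓘(ℝ, F) p) :
    d% (fun q => g.inner (ι q) (Y (ι q)) (Z (ι q))) p v =
      g.inner (ι p) (covAlong cov ι (fun q => Y (ι q)) p v) (Z (ι p))
        + g.inner (ι p) (Y (ι p)) (covAlong cov ι (fun q => Z (ι q)) p v) := by
  have hY' : MDiffAt (T% Y) (ι p) := (hY (ι p)).mdifferentiableAt (by simp)
  have hZ' : MDiffAt (T% Z) (ι p) := (hZ (ι p)).mdifferentiableAt (by simp)
  have hYZ : CMDiff ∞ (fun y => g.inner y (Y y) (Z y)) :=
    IsSmoothAlong.inner (ι := fun y : N => y) hY hZ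
  rw [covAlong_comp hY' hι, covAlong_comp hZ' hι, ← hLC.metric Y Z _ hY' hZ']
  exact mvfderiv_comp_apply p ((hYZ (ι p)).mdifferentiableAt (by simp)) hι v

variable [T2Space N]

lemma covAlong_J (hK : IsKaehler g cov J) (hs : IsSmoothAlong F ι s) (v : TangentSpace 𝓘(ℝ, F) p) :
    covAlong cov ι (fun q => J (ι q) (s q)) p v = J (ι p) (covAlong cov ι s p v) := by
  induction hs using IsSmoothAlong.induction (F := F) (E := E) (ι := ι) p with
  | congr s t _ _ hst ih =>
    have hJst : ∀ᶠ q in 𝓝 p, J (ι q) (s q) = J (ι q) (t q) := by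
      filter_upwards [hst] with q hq
      rw [hq]
    rw [← covAlong_congr_of_eventuallyEq hst, ← ih, covAlong_congr_of_eventuallyEq hJst]
  | add s t hs ht ihs iht =>
    simp only [map_add]
    rw [covAlong_add ((hs.apply_J hK.smooth_J).mdifferentiableAt p)
      ((ht.apply_J hK.smooth_J).mdifferentiableAt p), ihs, iht, ← map_add,
      ← covAlong_add (hs.mdifferentiableAt p) (ht.mdifferentiableAt p)]
  | smul a s ha hs ih =>
    have ha' : MDiffAt a p := (ha p).mdifferentiableAt (by simp)
    simp only [map_smul]
    rw [covAlong_smul ha' ((hs.apply_J hK.smooth_J).mdifferentiableAt p), ih,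
      covAlong_smul ha' (hs.mdifferentiableAt p), map_add, map_smul, map_smul]
  | comp Y hY hι =>
    have hι' : MDiffAt ι p := (hι p).mdifferentiableAt (by simp)
    have hY' : MDiffAt (T% Y) (ι p) := (hY (ι p)).mdifferentiableAt (by simp)
    have hJY : IsSmoothField (fun y => J y (Y y)) :=
      IsSmoothAlong.apply_J (ι := fun y : N => y) hY hK.smooth_J
    rw [covAlong_comp ((hJY (ι p)).mdifferentiableAt (by simp)) hι', covAlong_comp hY' hι',
      hK.parallel_J Y _ hY']

lemma mvfderiv_inner_along_of_comp (hs : IsSmoothAlong F ι s) (ht : IsSmoothAlong F ι t)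
    (v : TangentSpace 𝓘(ℝ, F) p)
    (hcomp : ∀ Y : ∀ x : N, TangentSpace 𝓘(ℝ, E) x, IsSmoothField Y →
      d% (fun q => g.inner (ι q) (Y (ι q)) (t q)) p v =
        g.inner (ι p) (covAlong cov ι (fun q => Y (ι q)) p v) (t p)
          + g.inner (ι p) (Y (ι p)) (covAlong cov ι t p v)) :
    d% (fun q => g.inner (ι q) (s q) (t q)) p v =
      g.inner (ι p) (covAlong cov ι s p v) (t p) + g.inner (ι p) (s p) (covAlong cov ι t p v) := by
  induction hs using IsSmoothAlong.induction (F := F) (E := E) (ι := ι) p with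
  | congr s s' _ _ hss' ih =>
    have hinner : (fun q => g.inner (ι q) (s' q) (t q)) =ᶠ[𝓝 p]
        fun q => g.inner (ι q) (s q) (t q) := by
      filter_upwards [hss'] with q hq
      rw [hq]
    rw [mvfderiv_congr_of_eventuallyEq hinner, ih, covAlong_congr_of_eventuallyEq hss',
      hss'.self_of_nhds]
  | add s s' hs hs' ih ih' =>
    have hd : MDiffAt (fun q => g.inner (ι q) (s q) (t q)) p :=
      (hs.inner ht p).mdifferentiableAt (by simp)
    have hd' : MDiffAt (fun q => g.inner (ι q) (s' q) (t q)) p :=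
      (hs'.inner ht p).mdifferentiableAt (by simp)
    simp only [map_add, add_apply, mvfderiv_fun_add hd hd', ih, ih',
      covAlong_add (hs.mdifferentiableAt p) (hs'.mdifferentiableAt p)]
    ring
  | smul a s ha hs ih =>
    have hda : MDiffAt a p := (ha p).mdifferentiableAt (by simp)
    have hd : MDiffAt (fun q => g.inner (ι q) (s q) (t q)) p :=
      (hs.inner ht p).mdifferentiableAt (by simp)
    simp only [map_smul, smul_apply]
    rw [mvfderiv_fun_smul hda hd, covAlong_smul hda (hs.mdifferentiableAt p)]
    simp only [map_smul, map_add, add_apply, smul_apply, ih, ContinuousLinearMap.smulRight_apply,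
      smul_eq_mul]
    ring
  | comp Y hY => exact hcomp Y hY

lemma mvfderiv_inner_along (hLC : IsLeviCivita g cov) (hs : IsSmoothAlong F ι s)
    (ht : IsSmoothAlong F ι t) (v : TangentSpace 𝓘(ℝ, F) p) :
    d% (fun q => g.inner (ι q) (s q) (t q)) p v =
      g.inner (ι p) (covAlong cov ι s p v) (t p) + g.inner (ι p) (s p) (covAlong cov ι t p v) := by
  have hι : MDiffAt ι p := (hs.contMDiff p).mdifferentiableAt (by simp)
  refine mvfderiv_inner_along_of_comp hs ht v fun Y hY => ?_
  have hYι := hY.along hs.contMDiff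
  simp only [g.symm (ι _) (Y (ι _)), g.symm (ι p) _ (t p)]
  rw [add_comm]
  exact mvfderiv_inner_along_of_comp ht hYι v fun Z hZ => mvfderiv_inner_comp hLC hZ hY hι v

lemma IsSmoothAlong.covAlong [IsManifold 𝓘(ℝ, F) ∞ M] (hLC : IsLeviCivita g cov)
    {X : ∀ p : M, TangentSpace 𝓘(ℝ, F) p} (hX : IsSmoothField X) (hs : IsSmoothAlong F ι s) :
    IsSmoothAlong F ι (fun q => covAlong cov ι s q (X q)) := by
  intro p
  induction hs using IsSmoothAlong.induction (F := F) (E := E) (ι := ι) p with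
  | congr s t _ _ hst ih =>
    refine ih.congr_of_eventuallyEq ?_
    filter_upwards [eventually_eventually_nhds.2 hst] with q hq
    rw [covAlong_congr_of_eventuallyEq hq]
  | add s t hs ht ihs iht =>
    simpa only [covAlong_add (hs.mdifferentiableAt _) (ht.mdifferentiableAt _)] using
      contMDiffAt_along_add ihs iht
  | smul a s ha hs ih =>
    have hda (q) : MDiffAt a q := (ha q).mdifferentiableAt (by simp)
    simpa only [covAlong_smul (hda _) (hs.mdifferentiableAt _)] using contMDiffAt_along_add
      (contMDiffAt_along_smul (contMDiffAt_mvfderiv_apply (ha p) (hX p) (by simp)) (hs p))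
      (contMDiffAt_along_smul (ha p) ih)
  | comp Y hY hι =>
    have hι' (q) : MDiffAt ι q := (hι q).mdifferentiableAt (by simp)
    have hY' (y) : MDiffAt (T% Y) y := (hY y).mdifferentiableAt (by simp)
    have hcovY := contMDiffOn_univ.1
      (hLC.smooth.contMDiff.contMDiff (σ := Y) (by simpa using hY.contMDiffOn))
    simp only [covAlong_comp (hY' _) (hι' _)]
    exact ContMDiff.clm_bundle_apply (F₁ := E) (F₂ := E) (hcovY.comp hι) (hX.dι hι) p

end Induction

lemma coord_eq_mvfderiv {x y : N} (hy : y ∈ (chartAt E x).source) (v : TangentSpace 𝓘(ℝ, E) y) :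
    coord x y v = d% (extChartAt 𝓘(ℝ, E) x) y v :=
  DFunLike.congr_fun (TangentBundle.continuousLinearMapAt_trivializationAt hy) v

lemma coord_dι {q : M} (hι : MDiffAt ι q) (hq : ι q ∈ (chartAt E (ι p)).source)
    (v : TangentSpace 𝓘(ℝ, F) q) :
    coord (ι p) (ι q) (dι F E ι q v) = d% (fun q => extChartAt 𝓘(ℝ, E) (ι p) (ι q)) q v := by
  rw [coord_eq_mvfderiv hq]
  exact (mfderiv_comp_apply q (mdifferentiableAt_extChartAt hq) hι v).symm

section Torsion

variable [IsManifold 𝓘(ℝ, F) ∞ M]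

lemma uncoord_mvfderiv_dι_sub [CompleteSpace F] {X Y : ∀ p : M, TangentSpace 𝓘(ℝ, F) p}
    (hX : CMDiffAt 1 (T% X) p) (hY : CMDiffAt 1 (T% Y) p) (hι : CMDiff ∞ ι) :
    uncoord (ι p) (ι p) (d% (fun q => coord (ι p) (ι q) (dι F E ι q (Y q))) p (X p)
      - d% (fun q => coord (ι p) (ι q) (dι F E ι q (X q))) p (Y p)) =
      dι F E ι p (VectorField.mlieBracket 𝓘(ℝ, F) X Y p) := by
  have hφι : CMDiffAt 2 (fun q => extChartAt 𝓘(ℝ, E) (ι p) (ι q)) p :=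
    contMDiffAt_extChartAt.comp p ((hι p).of_le (by norm_cast))
  have hι' (q) : MDiffAt ι q := (hι q).mdifferentiableAt (by simp)
  have hcoord (Z : ∀ p : M, TangentSpace 𝓘(ℝ, F) p) :
      (fun q => coord (ι p) (ι q) (dι F E ι q (Z q))) =ᶠ[𝓝 p]
        fun q => d% (fun q => extChartAt 𝓘(ℝ, E) (ι p) (ι q)) q (Z q) := by
    filter_upwards [(hι p).continuousAt.eventually (chart_source_mem_nhds E (ι p))] with q hq
    exact coord_dι (hι' q) hq (Z q)
  rw [mvfderiv_congr_of_eventuallyEq (hcoord X), mvfderiv_congr_of_eventuallyEq (hcoord Y),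
    ← mvfderiv_mlieBracket hX hY hφι, ← coord_dι (hι' p) (mem_chart_source E (ι p)),
    uncoord_coord (mem_chart_source E (ι p))]

variable [FiniteDimensional ℝ E]

/- Torsion-freeness for the fields with constant coefficients in the chart at `x`, whose bracket
vanishes at `x`. -/
lemma cov_extend_symm (hLC : IsLeviCivita g cov) {x : N} (v w : TangentSpace 𝓘(ℝ, E) x) :
    cov (FiberBundle.extend E w) x v = cov (FiberBundle.extend E v) x w := by
  have hs (u : TangentSpace 𝓘(ℝ, E) x) : CMDiffAt 1 (T% (FiberBundle.extend E u)) x :=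
    FiberBundle.contMDiffAt_extend 𝓘(ℝ, E) E u
  have htorsion := cov.torsion_eq_zero_iff.1 hLC.torsion_free
    ((hs v).mdifferentiableAt (by simp)) ((hs w).mdifferentiableAt (by simp))
  rw [FiberBundle.extend_apply_self, FiberBundle.extend_apply_self] at htorsion
  have hdι (y : N) : dι E E (fun y : N => y) y = .id ℝ _ := mfderiv_id
  have hconst (u : TangentSpace 𝓘(ℝ, E) x) :
      (fun y => coord x y (dι E E (fun y : N => y) y (FiberBundle.extend E u y))) =ᶠ[𝓝 x]
        fun _ => coord x x u := by
    filter_upwards [chart_source_mem_nhds E x] with y hy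
    rw [hdι, ContinuousLinearMap.id_apply, extend_eq_uncoord_coord hy, coord_uncoord hy]
  have hbracket := uncoord_mvfderiv_dι_sub (ι := fun y : N => y) (hs v) (hs w) contMDiff_id
  rw [mvfderiv_congr_of_eventuallyEq (hconst v), mvfderiv_congr_of_eventuallyEq (hconst w),
    mvfderiv_const, mvfderiv_const, hdι, zero_apply, zero_apply, sub_zero, map_zero] at hbracket
  exact sub_eq_zero.1 (htorsion.trans hbracket.symm)

lemma covAlong_dι_sub [CompleteSpace F] (hLC : IsLeviCivita g cov)
    {X Y : ∀ p : M, TangentSpace 𝓘(ℝ, F) p} (hX : CMDiffAt 1 (T% X) p) (hY : CMDiffAt 1 (T% Y) p)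
    (hι : CMDiff ∞ ι) :
    covAlong cov ι (fun q => dι F E ι q (Y q)) p (X p)
      - covAlong cov ι (fun q => dι F E ι q (X q)) p (Y p) =
      dι F E ι p (VectorField.mlieBracket 𝓘(ℝ, F) X Y p) := by
  have hιp := (hι p).continuousAt
  rw [covAlong_eq_coord hιp, covAlong_eq_coord hιp, ← uncoord_mvfderiv_dι_sub hX hY hι, map_sub,
    cov_extend_symm hLC (dι F E ι p (X p)) (dι F E ι p (Y p)), add_sub_add_right_eq_sub]

end Torsion

end LeviCivita

section Parts

variable {F : Type*} [NormedAddCommGroup F] [NormedSpace ℝ F]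
  {M : Type*} [TopologicalSpace M] [ChartedSpace F M]
  {E : Type*} [NormedAddCommGroup E] [NormedSpace ℝ E]
  {N : Type*} [TopologicalSpace N] [ChartedSpace E N] [IsManifold 𝓘(ℝ, E) ∞ N]
  {g : ContMDiffRiemannianMetric 𝓘(ℝ, E) ∞ E (fun x : N => TangentSpace 𝓘(ℝ, E) x)}
  {ι : M → N} {p : M}

lemma eq_zero_of_inner_self {x : N} {v : TangentSpace 𝓘(ℝ, E) x} (h : g.inner x v v = 0) :
    v = 0 := by
  by_contra hv
  exact (g.pos x v hv).ne' h

lemma metric_comm (v w : TangentSpace 𝓘(ℝ, F) p) : metric g ι p v w = metric g ι p w v :=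
  g.symm _ _ _

lemma metric_add_left (v v' w : TangentSpace 𝓘(ℝ, F) p) :
    metric g ι p (v + v') w = metric g ι p v w + metric g ι p v' w := by
  simp only [metric, map_add, add_apply]

lemma metric_add_right (v w w' : TangentSpace 𝓘(ℝ, F) p) :
    metric g ι p v (w + w') = metric g ι p v w + metric g ι p v w' := by
  simp only [metric, map_add]

lemma metric_smul_left (a : ℝ) (v w : TangentSpace 𝓘(ℝ, F) p) :
    metric g ι p (a • v) w = a * metric g ι p v w := by
  simp only [metric, map_smul, smul_apply, smul_eq_mul]

lemma metric_sub_left (v v' w : TangentSpace 𝓘(ℝ, F) p) :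
    metric g ι p (v - v') w = metric g ι p v w - metric g ι p v' w := by
  simp only [metric, map_sub, sub_apply]

lemma metric_neg_left (v w : TangentSpace 𝓘(ℝ, F) p) :
    metric g ι p (-v) w = -metric g ι p v w := by
  simp only [metric, map_neg, neg_apply]

lemma eq_zero_of_metric_self (hι : IsImmersed F E ι) {v : TangentSpace 𝓘(ℝ, F) p}
    (h : metric g ι p v v = 0) : v = 0 :=
  hι.injective p ((eq_zero_of_inner_self h).trans (map_zero _).symm)

lemma eq_of_metric_eq (hι : IsImmersed F E ι) {v w : TangentSpace 𝓘(ℝ, F) p}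
    (h : ∀ u, metric g ι p v u = metric g ι p w u) : v = w :=
  sub_eq_zero.1 <| eq_zero_of_metric_self (g := g) hι <| by rw [metric_sub_left, h, sub_self]

lemma exists_ne_zero_metric_eq_zero [FiniteDimensional ℝ F] (hF : 1 < Module.finrank ℝ F)
    (v : TangentSpace 𝓘(ℝ, F) p) :
    ∃ w : TangentSpace 𝓘(ℝ, F) p, w ≠ 0 ∧ metric g ι p v w = 0 := by
  have : FiniteDimensional ℝ (TangentSpace 𝓘(ℝ, F) p) := inferInstanceAs (FiniteDimensional ℝ F)
  let L : TangentSpace 𝓘(ℝ, F) p →L[ℝ] ℝ := g.inner (ι p) (dι F E ι p v) ∘L dι F E ι p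
  have hker : LinearMap.ker L.toLinearMap ≠ ⊥ :=
    LinearMap.ker_ne_bot_of_finrank_lt ((Module.finrank_self ℝ).trans_lt hF)
  obtain ⟨w, hw, hw0⟩ := Submodule.exists_mem_ne_zero_of_ne_bot hker
  exact ⟨w, hw0, hw⟩

variable [FiniteDimensional ℝ E]

lemma inner_normalPart_dι (w : TangentSpace 𝓘(ℝ, E) (ι p)) (u : TangentSpace 𝓘(ℝ, F) p) :
    g.inner (ι p) (normalPart F g ι p w) (dι F E ι p u) = 0 :=
  (exists_tangentPart g ι p w).choose_spec u

lemma dι_tangentPart_add_normalPart (w : TangentSpace 𝓘(ℝ, E) (ι p)) :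
    dι F E ι p (tangentPart g ι p w) + normalPart F g ι p w = w :=
  add_sub_cancel _ _

lemma metric_tangentPart (w : TangentSpace 𝓘(ℝ, E) (ι p)) (u : TangentSpace 𝓘(ℝ, F) p) :
    metric g ι p (tangentPart g ι p w) u = g.inner (ι p) w (dι F E ι p u) := by
  nth_rewrite 2 [← dι_tangentPart_add_normalPart (F := F) (g := g) w]
  rw [map_add, add_apply, inner_normalPart_dι, add_zero, metric]

lemma tangentPart_dι (hι : IsImmersed F E ι) (v : TangentSpace 𝓘(ℝ, F) p) :
    tangentPart g ι p (dι F E ι p v) = v :=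
  eq_of_metric_eq hι fun u => metric_tangentPart (dι F E ι p v) u

lemma tangentPart_of_normal (hι : IsImmersed F E ι) {ν : TangentSpace 𝓘(ℝ, E) (ι p)}
    (hν : ∀ u, g.inner (ι p) ν (dι F E ι p u) = 0) :
    (tangentPart g ι p ν : TangentSpace 𝓘(ℝ, F) p) = 0 :=
  eq_zero_of_metric_self hι ((metric_tangentPart ν _).trans (hν _))

lemma tangentPart_add (hι : IsImmersed F E ι) (w w' : TangentSpace 𝓘(ℝ, E) (ι p)) :
    (tangentPart g ι p (w + w') : TangentSpace 𝓘(ℝ, F) p) =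
      tangentPart g ι p w + tangentPart g ι p w' :=
  eq_of_metric_eq (g := g) hι fun u => by
    simp only [metric_add_left, metric_tangentPart, map_add, add_apply]

lemma tangentPart_sub (hι : IsImmersed F E ι) (w w' : TangentSpace 𝓘(ℝ, E) (ι p)) :
    (tangentPart g ι p (w - w') : TangentSpace 𝓘(ℝ, F) p) =
      tangentPart g ι p w - tangentPart g ι p w' :=
  eq_of_metric_eq (g := g) hι fun u => by
    simp only [metric_sub_left, metric_tangentPart, map_sub, sub_apply]

lemma tangentPart_neg (hι : IsImmersed F E ι) (w : TangentSpace 𝓘(ℝ, E) (ι p)) :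
    (tangentPart g ι p (-w) : TangentSpace 𝓘(ℝ, F) p) = -tangentPart g ι p w :=
  eq_of_metric_eq (g := g) hι fun u => by
    simp only [metric_neg_left, metric_tangentPart, map_neg, neg_apply]

lemma normalPart_dι (hι : IsImmersed F E ι) (v : TangentSpace 𝓘(ℝ, F) p) :
    normalPart F g ι p (dι F E ι p v) = 0 := by
  rw [normalPart, tangentPart_dι hι, sub_self]

lemma normalPart_of_normal (hι : IsImmersed F E ι) {ν : TangentSpace 𝓘(ℝ, E) (ι p)}
    (hν : ∀ u, g.inner (ι p) ν (dι F E ι p u) = 0) : normalPart F g ι p ν = ν := by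
  rw [normalPart, tangentPart_of_normal hι hν, map_zero, sub_zero]

lemma normalPart_add (hι : IsImmersed F E ι) (w w' : TangentSpace 𝓘(ℝ, E) (ι p)) :
    normalPart F g ι p (w + w') = normalPart F g ι p w + normalPart F g ι p w' := by
  simp only [normalPart, tangentPart_add hι, map_add]
  abel

lemma normalPart_sub (hι : IsImmersed F E ι) (w w' : TangentSpace 𝓘(ℝ, E) (ι p)) :
    normalPart F g ι p (w - w') = normalPart F g ι p w - normalPart F g ι p w' := by
  simp only [normalPart, tangentPart_sub hι, map_sub]
  abel

end Parts

section Gram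

variable {F : Type*} [NormedAddCommGroup F] [NormedSpace ℝ F]
  {M : Type*} [TopologicalSpace M] [ChartedSpace F M] [IsManifold 𝓘(ℝ, F) ∞ M]
  {E : Type*} [NormedAddCommGroup E] [NormedSpace ℝ E]
  {N : Type*} [TopologicalSpace N] [ChartedSpace E N] [IsManifold 𝓘(ℝ, E) ∞ N]
  {g : ContMDiffRiemannianMetric 𝓘(ℝ, E) ∞ E (fun x : N => TangentSpace 𝓘(ℝ, E) x)}
  {ι : M → N} {s : ∀ p : M, TangentSpace 𝓘(ℝ, E) (ι p)} {p q : M}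

variable (F) in
/-- The covector `⟨w, dι ·⟩` on `T_qM` in the chart of `M` at `p`. -/
def gramCovector (g : ContMDiffRiemannianMetric 𝓘(ℝ, E) ∞ E (fun x : N => TangentSpace 𝓘(ℝ, E) x))
    (ι : M → N) (p q : M) (w : TangentSpace 𝓘(ℝ, E) (ι q)) : F →L[ℝ] ℝ :=
  g.inner (ι q) w ∘L dι F E ι q ∘L uncoord p q

variable (F) in
/-- The Gram form of the induced metric on `T_qM` in the chart of `M` at `p`. Its inverse computes
tangential parts, which shows that they depend smoothly on the point. -/
def gramForm (g : ContMDiffRiemannianMetric 𝓘(ℝ, E) ∞ E (fun x : N => TangentSpace 𝓘(ℝ, E) x))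
    (ι : M → N) (p q : M) : F →L[ℝ] F →L[ℝ] ℝ :=
  (dι F E ι q ∘L uncoord p q).precomp ℝ ∘L g.inner (ι q) ∘L dι F E ι q ∘L uncoord p q

lemma gramForm_apply (v : F) :
    gramForm F g ι p q v = gramCovector F g ι p q (dι F E ι q (uncoord p q v)) := rfl

lemma contMDiffAt_dι_uncoord (hι : CMDiff ∞ ι) (v : F) :
    CMDiffAt ∞ (fun q => (⟨ι q, dι F E ι q (uncoord p q v)⟩ : TangentBundle 𝓘(ℝ, E) N)) p :=
  (hι.contMDiff_tangentMap (m := ∞) (by simp)).contMDiffAt.comp p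
    ((contMDiffOn_uncoord p v).contMDiffAt (chart_source_mem_nhds F p))

variable [FiniteDimensional ℝ F]

lemma contMDiffAt_gramCovector (hι : CMDiff ∞ ι)
    (hs : CMDiffAt ∞ (fun q => (⟨ι q, s q⟩ : TangentBundle 𝓘(ℝ, E) N)) p) :
    CMDiffAt ∞ (fun q => gramCovector F g ι p q (s q)) p :=
  contMDiffAt_clm_of_apply fun v => contMDiffAt_inner_along hs (contMDiffAt_dι_uncoord hι v)

lemma contMDiffAt_gramForm (hι : CMDiff ∞ ι) : CMDiffAt ∞ (gramForm F g ι p) p :=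
  contMDiffAt_clm_of_apply fun v => contMDiffAt_gramCovector hι (contMDiffAt_dι_uncoord hι v)

lemma isInvertible_gramForm (hι : IsImmersed F E ι) (hq : q ∈ (chartAt F p).source) :
    (gramForm F g ι p q).IsInvertible :=
  isInvertible_of_apply_self_ne_zero fun v hv => by
    have huncoord : uncoord p q v = 0 := eq_zero_of_metric_self (g := g) hι hv
    rw [← coord_uncoord hq v, huncoord, map_zero]

variable [FiniteDimensional ℝ E]

lemma coord_tangentPart (hι : IsImmersed F E ι) (hq : q ∈ (chartAt F p).source)
    (w : TangentSpace 𝓘(ℝ, E) (ι q)) :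
    coord p q (tangentPart g ι q w) =
      (gramForm F g ι p q).inverse (gramCovector F g ι p q w) := by
  have hgram : gramForm F g ι p q (coord p q (tangentPart g ι q w)) =
      gramCovector F g ι p q w := by
    rw [gramForm_apply, uncoord_coord hq]
    exact ContinuousLinearMap.ext fun v => metric_tangentPart w (uncoord p q v)
  rw [← hgram, (isInvertible_gramForm hι hq).inverse_apply_self]

lemma IsSmoothAlong.tangentPart (hι : IsImmersed F E ι) (hs : IsSmoothAlong F ι s) :
    IsSmoothField (fun q => (tangentPart g ι q (s q) : TangentSpace 𝓘(ℝ, F) q)) := fun p => by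
  have hinverse : CMDiffAt ∞ (fun q => (gramForm F g ι p q).inverse) p :=
    (isInvertible_gramForm hι (mem_chart_source F p)).contDiffAt_map_inverse.contMDiffAt.comp p
      (contMDiffAt_gramForm hι.smooth)
  refine (contMDiffAt_along_iff_coord (ι := fun q : M => q) (mem_chart_source F p)).2
    ⟨contMDiffAt_id, (hinverse.clm_apply
      (contMDiffAt_gramCovector (g := g) hι.smooth (hs p))).congr_of_eventuallyEq ?_⟩
  filter_upwards [chart_source_mem_nhds F p] with q hq using coord_tangentPart hι hq (s q)

lemma IsSmoothAlong.normalPart (hι : IsImmersed F E ι) (hs : IsSmoothAlong F ι s) :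
    IsSmoothAlong F ι (fun q => normalPart F g ι q (s q)) :=
  hs.sub ((hs.tangentPart hι).dι hι.smooth)

end Gram

section SmoothField

variable {F : Type*} [NormedAddCommGroup F] [NormedSpace ℝ F]
  {M : Type*} [TopologicalSpace M] [ChartedSpace F M] [IsManifold 𝓘(ℝ, F) ∞ M]
  {E : Type*} [NormedAddCommGroup E] [NormedSpace ℝ E]
  {N : Type*} [TopologicalSpace N] [ChartedSpace E N] [IsManifold 𝓘(ℝ, E) ∞ N]
  {g : ContMDiffRiemannianMetric 𝓘(ℝ, E) ∞ E (fun x : N => TangentSpace 𝓘(ℝ, E) x)}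
  {ι : M → N} {X Y : ∀ p : M, TangentSpace 𝓘(ℝ, F) p}

lemma IsSmoothField.sub (hX : IsSmoothField X) (hY : IsSmoothField Y) :
    IsSmoothField (fun q => X q - Y q) :=
  IsSmoothAlong.sub (ι := fun q : M => q) hX hY

lemma IsSmoothField.mlieBracket [CompleteSpace F] (hX : IsSmoothField X) (hY : IsSmoothField Y) :
    IsSmoothField (VectorField.mlieBracket 𝓘(ℝ, F) X Y) := by
  have : IsManifold 𝓘(ℝ, F) (minSmoothness ℝ 2) M := by
    rw [minSmoothness_of_isRCLikeNormedField]
    infer_instance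
  have : IsManifold 𝓘(ℝ, F) (((⊤ : ℕ∞) : ℕ∞ω) + 1) M := by simpa
  exact ContDiff.mlieBracket_vectorField (m := ⊤) (n := ⊤) hX hY
    (by simp [minSmoothness_of_isRCLikeNormedField])

lemma IsSmoothField.metric (hX : IsSmoothField X) (hY : IsSmoothField Y) (hι : CMDiff ∞ ι) :
    CMDiff ∞ (fun q => metric g ι q (X q) (Y q)) :=
  (hX.dι hι).inner (hY.dι hι)

end SmoothField

section Geometry

variable {F : Type*} [NormedAddCommGroup F] [NormedSpace ℝ F]
  {M : Type*} [TopologicalSpace M] [ChartedSpace F M]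
  {E : Type*} [NormedAddCommGroup E] [NormedSpace ℝ E]
  {N : Type*} [TopologicalSpace N] [ChartedSpace E N] [IsManifold 𝓘(ℝ, E) ∞ N]
  {g : ContMDiffRiemannianMetric 𝓘(ℝ, E) ∞ E (fun x : N => TangentSpace 𝓘(ℝ, E) x)}
  {cov : CovariantDerivative 𝓘(ℝ, E) E (fun x : N => TangentSpace 𝓘(ℝ, E) x)}
  {ι : M → N} {X Y Z W : ∀ p : M, TangentSpace 𝓘(ℝ, F) p} {p : M}

lemma covAlong_neg_right (hι : ContinuousAt ι p) (s : ∀ p : M, TangentSpace 𝓘(ℝ, E) (ι p))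
    (v : TangentSpace 𝓘(ℝ, F) p) : covAlong cov ι s p (-v) = -covAlong cov ι s p v := by
  simp only [covAlong_eq_coord hι, map_neg, neg_add]

variable [FiniteDimensional ℝ E]

lemma dι_nabla_add_sff :
    dι F E ι p (nabla g cov ι X Y p) + sff g cov ι X Y p =
      covAlong cov ι (fun q => dι F E ι q (Y q)) p (X p) :=
  dι_tangentPart_add_normalPart _

lemma nabla_mlieBracket_swap (hι : IsImmersed F E ι) :
    nabla g cov ι (VectorField.mlieBracket 𝓘(ℝ, F) X Y) Z p =
      -nabla g cov ι (VectorField.mlieBracket 𝓘(ℝ, F) Y X) Z p := by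
  rw [nabla, VectorField.mlieBracket_swap_apply,
    covAlong_neg_right (hι.smooth p).continuousAt, tangentPart_neg hι, nabla]

lemma curv_swap (hι : IsImmersed F E ι) : curv g cov ι X Y Z p = -curv g cov ι Y X Z p := by
  rw [curv, curv, nabla_mlieBracket_swap hι]
  abel

variable [IsManifold 𝓘(ℝ, F) ∞ M]

lemma nabla_sub_right (hι : IsImmersed F E ι) (hY : IsSmoothField Y) (hZ : IsSmoothField Z) :
    nabla g cov ι X (fun q => Y q - Z q) p = nabla g cov ι X Y p - nabla g cov ι X Z p := by
  have hadd := covAlong_add (cov := cov) (((hY.sub hZ).dι hι.smooth).mdifferentiableAt p)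
    ((hZ.dι hι.smooth).mdifferentiableAt p) (X p)
  simp only [← map_add, sub_add_cancel] at hadd
  rw [nabla, nabla, nabla, hadd, tangentPart_add hι, add_sub_cancel_right]

lemma nabla_sub_nabla [CompleteSpace F] (hLC : IsLeviCivita g cov) (hι : IsImmersed F E ι)
    (hX : IsSmoothField X) (hY : IsSmoothField Y) :
    nabla g cov ι X Y p - nabla g cov ι Y X p = VectorField.mlieBracket 𝓘(ℝ, F) X Y p := by
  rw [nabla, nabla, ← tangentPart_sub hι, covAlong_dι_sub hLC ((hX p).of_le ENat.LEInfty.out)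
    ((hY p).of_le ENat.LEInfty.out) hι.smooth, tangentPart_dι hι]

lemma sff_comm [CompleteSpace F] (hLC : IsLeviCivita g cov) (hι : IsImmersed F E ι)
    (hX : IsSmoothField X) (hY : IsSmoothField Y) :
    sff g cov ι X Y p = sff g cov ι Y X p := by
  rw [← sub_eq_zero, sff, sff, ← normalPart_sub hι, covAlong_dι_sub hLC
    ((hX p).of_le ENat.LEInfty.out) ((hY p).of_le ENat.LEInfty.out) hι.smooth, normalPart_dι hι]

variable [T2Space N]

lemma mvfderiv_metric (hLC : IsLeviCivita g cov) (hι : IsImmersed F E ι)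
    (hY : IsSmoothField Y) (hZ : IsSmoothField Z) :
    d% (fun q => metric g ι q (Y q) (Z q)) p (X p) =
      metric g ι p (nabla g cov ι X Y p) (Z p) + metric g ι p (Y p) (nabla g cov ι X Z p) := by
  rw [metric_comm (Y p), nabla, nabla, metric_tangentPart, metric_tangentPart,
    g.symm (ι p) _ (dι F E ι p (Y p))]
  exact mvfderiv_inner_along hLC (hY.dι hι.smooth) (hZ.dι hι.smooth) (X p)

variable [FiniteDimensional ℝ F]

lemma IsSmoothField.nabla (hLC : IsLeviCivita g cov) (hι : IsImmersed F E ι)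
    (hX : IsSmoothField X) (hY : IsSmoothField Y) : IsSmoothField (nabla g cov ι X Y) :=
  ((hY.dι hι.smooth).covAlong hLC hX).tangentPart hι

lemma IsSmoothField.sff (hLC : IsLeviCivita g cov) (hι : IsImmersed F E ι)
    (hX : IsSmoothField X) (hY : IsSmoothField Y) : IsSmoothAlong F ι (sff g cov ι X Y) :=
  ((hY.dι hι.smooth).covAlong hLC hX).normalPart hι

lemma IsSmoothField.curv (hLC : IsLeviCivita g cov) (hι : IsImmersed F E ι)
    (hX : IsSmoothField X) (hY : IsSmoothField Y) (hZ : IsSmoothField Z) :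
    IsSmoothField (curv g cov ι X Y Z) := by
  have : CompleteSpace F := FiniteDimensional.complete ℝ F
  exact ((hX.nabla hLC hι (hY.nabla hLC hι hZ)).sub (hY.nabla hLC hι (hX.nabla hLC hι hZ))).sub
    ((hX.mlieBracket hY).nabla hLC hι hZ)

lemma mlieBracket_mlieBracket_eq_nabla (hLC : IsLeviCivita g cov) (hι : IsImmersed F E ι)
    (hX : IsSmoothField X) (hY : IsSmoothField Y) (hZ : IsSmoothField Z) :
    VectorField.mlieBracket 𝓘(ℝ, F) X (VectorField.mlieBracket 𝓘(ℝ, F) Y Z) p =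
      nabla g cov ι X (nabla g cov ι Y Z) p - nabla g cov ι X (nabla g cov ι Z Y) p
        - nabla g cov ι (VectorField.mlieBracket 𝓘(ℝ, F) Y Z) X p := by
  have : CompleteSpace F := FiniteDimensional.complete ℝ F
  rw [← nabla_sub_nabla hLC hι hX (hY.mlieBracket hZ),
    ← nabla_sub_right hι (hY.nabla hLC hι hZ) (hZ.nabla hLC hι hY)]
  simp only [nabla_sub_nabla hLC hι hY hZ]

/- The Jacobi identity, with both brackets written in terms of `∇`. -/
lemma curv_bianchi (hLC : IsLeviCivita g cov) (hι : IsImmersed F E ι)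
    (hX : IsSmoothField X) (hY : IsSmoothField Y) (hZ : IsSmoothField Z) :
    curv g cov ι X Y Z p + curv g cov ι Y Z X p + curv g cov ι Z X Y p = 0 := by
  have : CompleteSpace F := FiniteDimensional.complete ℝ F
  have : IsManifold 𝓘(ℝ, F) (minSmoothness ℝ 3) M := by
    rw [minSmoothness_of_isRCLikeNormedField]
    infer_instance
  have hle : minSmoothness ℝ 2 ≤ ∞ := by
    rw [minSmoothness_of_isRCLikeNormedField]
    exact ENat.LEInfty.out
  have hjacobi := VectorField.leibniz_identity_mlieBracket_apply (I := 𝓘(ℝ, F))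
    ((hX p).of_le hle) ((hY p).of_le hle) ((hZ p).of_le hle)
  rw [VectorField.mlieBracket_swap_apply (V := VectorField.mlieBracket 𝓘(ℝ, F) X Y),
    mlieBracket_mlieBracket_eq_nabla hLC hι hX hY hZ,
    mlieBracket_mlieBracket_eq_nabla hLC hι hZ hX hY,
    mlieBracket_mlieBracket_eq_nabla hLC hι hY hX hZ,
    nabla_mlieBracket_swap hι (X := X) (Y := Z), ← sub_eq_zero] at hjacobi
  rw [← hjacobi]
  simp only [curv]
  abel

lemma mvfderiv_mvfderiv_metric (hLC : IsLeviCivita g cov) (hι : IsImmersed F E ι)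
    (hY : IsSmoothField Y) (hZ : IsSmoothField Z) (hW : IsSmoothField W) :
    d% (fun q => d% (fun q => metric g ι q (Z q) (W q)) q (Y q)) p (X p) =
      metric g ι p (nabla g cov ι X (nabla g cov ι Y Z) p) (W p)
        + metric g ι p (nabla g cov ι Y Z p) (nabla g cov ι X W p)
        + (metric g ι p (nabla g cov ι X Z p) (nabla g cov ι Y W p)
          + metric g ι p (Z p) (nabla g cov ι X (nabla g cov ι Y W) p)) := by
  have hYZ := hY.nabla hLC hι hZ
  have hYW := hY.nabla hLC hι hW
  simp only [mvfderiv_metric hLC hι hZ hW]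
  rw [mvfderiv_fun_add ((hYZ.metric hW hι.smooth p).mdifferentiableAt (by simp))
    ((hZ.metric hYW hι.smooth p).mdifferentiableAt (by simp)), add_apply,
    mvfderiv_metric hLC hι hYZ hW, mvfderiv_metric hLC hι hZ hYW]

lemma metric_curv_antisymm (hLC : IsLeviCivita g cov) (hι : IsImmersed F E ι)
    (hX : IsSmoothField X) (hY : IsSmoothField Y) (hZ : IsSmoothField Z) (hW : IsSmoothField W) :
    metric g ι p (curv g cov ι X Y Z p) (W p) = -metric g ι p (curv g cov ι X Y W p) (Z p) := by
  have : CompleteSpace F := FiniteDimensional.complete ℝ F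
  have h := mvfderiv_mlieBracket ((hX p).of_le ENat.LEInfty.out) ((hY p).of_le ENat.LEInfty.out)
    ((hZ.metric hW (g := g) hι.smooth p).of_le ENat.LEInfty.out)
  rw [mvfderiv_mvfderiv_metric hLC hι hY hZ hW, mvfderiv_mvfderiv_metric hLC hι hX hZ hW,
    mvfderiv_metric hLC hι hZ hW] at h
  simp only [curv, metric_sub_left, metric_comm (Z p)] at h ⊢
  linarith

end Geometry

section ConstantCurvature

variable {F : Type*} [NormedAddCommGroup F] [NormedSpace ℝ F]
  {M : Type*} [TopologicalSpace M] [ChartedSpace F M] [IsManifold 𝓘(ℝ, F) ∞ M]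
  {E : Type*} [NormedAddCommGroup E] [NormedSpace ℝ E]
  {N : Type*} [TopologicalSpace N] [ChartedSpace E N] [IsManifold 𝓘(ℝ, E) ∞ N]
  {g : ContMDiffRiemannianMetric 𝓘(ℝ, E) ∞ E (fun x : N => TangentSpace 𝓘(ℝ, E) x)}
  {cov : CovariantDerivative 𝓘(ℝ, E) E (fun x : N => TangentSpace 𝓘(ℝ, E) x)}
  {ι : M → N} {p : M}

variable (F M) in
/-- The additive group of smooth vector fields on `M`. Tensors on `M` at a point are treated as
multiadditive forms on this group. -/
def smoothFields : AddSubgroup (∀ p : M, TangentSpace 𝓘(ℝ, F) p) where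
  carrier := {X | IsSmoothField X}
  add_mem' hX hY := IsSmoothAlong.add (ι := fun q : M => q) hX hY
  zero_mem' := contMDiff_zeroSection ℝ _
  neg_mem' hX := IsSmoothAlong.neg (ι := fun q : M => q) hX

variable [FiniteDimensional ℝ F] [FiniteDimensional ℝ E] [T2Space N]

lemma isCurvatureLike_metric_curv (hLC : IsLeviCivita g cov) (hι : IsImmersed F E ι) :
    IsCurvatureLike fun X Y Z W : smoothFields F M =>
      metric g ι p (curv g cov ι X.1 Y.1 Z.1 p) (W.1 p) where
  antisymm_left X Y Z W := by rw [curv_swap hι, metric_neg_left]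
  antisymm_right X Y Z W := metric_curv_antisymm hLC hι X.2 Y.2 Z.2 W.2
  bianchi X Y Z W := by
    rw [← metric_add_left, ← metric_add_left, curv_bianchi hLC hι X.2 Y.2 Z.2, metric, map_zero,
      map_zero, zero_apply]
  add_right X Y Z W W' := metric_add_right _ _ _

lemma HasConstantCurvature.curv_eq [T2Space M] {c : ℝ} {X Y Z : ∀ p : M, TangentSpace 𝓘(ℝ, F) p}
    (hc : HasConstantCurvature F g cov ι c) (hLC : IsLeviCivita g cov) (hι : IsImmersed F E ι)
    (hX : IsSmoothField X) (hY : IsSmoothField Y) (hZ : IsSmoothField Z) :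
    curv g cov ι X Y Z p =
      c • (metric g ι p (Y p) (Z p) • X p - metric g ι p (X p) (Z p) • Y p) := by
  refine eq_of_metric_eq (g := g) hι fun w => ?_
  obtain ⟨W, hW, rfl⟩ := exists_isSmoothField_eq p w
  have hmodel : IsCurvatureLike fun X Y Z W : smoothFields F M =>
      c * (metric g ι p (Y.1 p) (Z.1 p) * metric g ι p (X.1 p) (W.1 p)
        - metric g ι p (X.1 p) (Z.1 p) * metric g ι p (Y.1 p) (W.1 p)) :=
    .of_symm (B := fun X Y : smoothFields F M => metric g ι p (X.1 p) (Y.1 p))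
      (fun _ _ => metric_comm _ _) (fun _ _ _ => metric_add_right _ _ _) c
  rw [metric_smul_left, metric_sub_left, metric_smul_left, metric_smul_left]
  refine (isCurvatureLike_metric_curv hLC hι).eq_of_sectional hmodel (fun X Y => ?_)
    ⟨X, hX⟩ ⟨Y, hY⟩ ⟨Z, hZ⟩ ⟨W, hW⟩
  rw [hc _ _ X.2 Y.2 p, metric_comm (Y.1 p) (X.1 p)]
  ring

end ConstantCurvature

section TotallyReal

variable {F : Type*} [NormedAddCommGroup F] [NormedSpace ℝ F]
  {M : Type*} [TopologicalSpace M] [ChartedSpace F M]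
  {E : Type*} [NormedAddCommGroup E] [NormedSpace ℝ E] [FiniteDimensional ℝ E]
  {N : Type*} [TopologicalSpace N] [ChartedSpace E N] [IsManifold 𝓘(ℝ, E) ∞ N]
  {g : ContMDiffRiemannianMetric 𝓘(ℝ, E) ∞ E (fun x : N => TangentSpace 𝓘(ℝ, E) x)}
  {cov : CovariantDerivative 𝓘(ℝ, E) E (fun x : N => TangentSpace 𝓘(ℝ, E) x)}
  {J : ∀ x : N, TangentSpace 𝓘(ℝ, E) x →L[ℝ] TangentSpace 𝓘(ℝ, E) x}
  {ι : M → N} {X Y Z U V : ∀ p : M, TangentSpace 𝓘(ℝ, F) p} {p : M}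

variable (g cov J ι) in
/-- The cubic form `g(σ(X, Y), J v)` of a submanifold at `p`, for `v ∈ T_pM`. It is totally
symmetric if the submanifold is totally real. -/
def cubicForm (X Y : ∀ p : M, TangentSpace 𝓘(ℝ, F) p) (p : M) (v : TangentSpace 𝓘(ℝ, F) p) : ℝ :=
  g.inner (ι p) (sff g cov ι X Y p) (J (ι p) (dι F E ι p v))

lemma cubicForm_add (v w : TangentSpace 𝓘(ℝ, F) p) :
    cubicForm g cov J ι X Y p (v + w) =
      cubicForm g cov J ι X Y p v + cubicForm g cov J ι X Y p w := by
  simp only [cubicForm, map_add]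

lemma cubicForm_sub (v w : TangentSpace 𝓘(ℝ, F) p) :
    cubicForm g cov J ι X Y p (v - w) =
      cubicForm g cov J ι X Y p v - cubicForm g cov J ι X Y p w := by
  simp only [cubicForm, map_sub]

lemma cubicForm_smul (a : ℝ) (v : TangentSpace 𝓘(ℝ, F) p) :
    cubicForm g cov J ι X Y p (a • v) = a * cubicForm g cov J ι X Y p v := by
  simp only [cubicForm, map_smul, smul_eq_mul]

lemma metric_eq_cubicForm (hK : IsKaehler g cov J) {W : ∀ p : M, TangentSpace 𝓘(ℝ, F) p}
    (hσ : sff g cov ι X Y = fun q => J (ι q) (dι F E ι q (W q))) (v : TangentSpace 𝓘(ℝ, F) p) :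
    metric g ι p (W p) v = cubicForm g cov J ι X Y p v := by
  rw [cubicForm, hσ, hK.J_isometry, metric]

lemma isNormal_sff : IsNormal F g ι (sff g cov ι X Y) := fun p v => by
  rw [g.symm]
  exact inner_normalPart_dι _ v

lemma IsTotallyReal.inner_covAlong_J (hreal : IsTotallyReal F g J ι)
    (v : TangentSpace 𝓘(ℝ, F) p) :
    g.inner (ι p) (covAlong cov ι (fun q => dι F E ι q (Y q)) p (X p)) (J (ι p) (dι F E ι p v)) =
      cubicForm g cov J ι X Y p v := by
  rw [← dι_nabla_add_sff (g := g), map_add, add_apply, g.symm, hreal, zero_add, cubicForm]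

section NormalBundle

variable {ξ η : ∀ p : M, TangentSpace 𝓘(ℝ, E) (ι p)}

lemma isNormal_fOp : IsNormal F g ι (fOp F g J ι ξ) := fun p v => by
  rw [g.symm]
  exact inner_normalPart_dι _ v

lemma inner_fOp_left (hη : IsNormal F g ι η) :
    g.inner (ι p) (fOp F g J ι ξ p) (η p) = g.inner (ι p) (J (ι p) (ξ p)) (η p) := by
  rw [fOp, normalPart, map_sub, sub_apply, hη, sub_zero]

lemma inner_fOp_comm (hK : IsKaehler g cov J) (hξ : IsNormal F g ι ξ) (hη : IsNormal F g ι η) :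
    g.inner (ι p) (fOp F g J ι ξ p) (η p) = -g.inner (ι p) (ξ p) (fOp F g J ι η p) := by
  rw [g.symm _ (ξ p), inner_fOp_left hη, inner_fOp_left hξ, hK.inner_J_left, g.symm]

lemma fOp_eq_zero_of_fOp_fOp (hK : IsKaehler g cov J) (hξ : IsNormal F g ι ξ)
    (hff : fOp F g J ι (fOp F g J ι ξ) p = 0) : fOp F g J ι ξ p = 0 :=
  eq_zero_of_inner_self (g := g) <| by
    rw [inner_fOp_comm hK hξ isNormal_fOp, hff, map_zero, neg_zero]

lemma fOp_J (hK : IsKaehler g cov J) (hι : IsImmersed F E ι) :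
    fOp F g J ι (fun q => J (ι q) (dι F E ι q (X q))) = fun _ => 0 := by
  funext p
  rw [fOp, hK.J_sq, ← map_neg, normalPart_dι hι]

lemma normalConn_zero (hι : IsImmersed F E ι) : normalConn g cov ι X (fun _ => 0) p = 0 := by
  rw [normalConn, covAlong_zero (hι.smooth p).continuousAt]
  exact normalPart_of_normal hι fun u => by rw [map_zero, zero_apply]

end NormalBundle

variable [IsManifold 𝓘(ℝ, F) ∞ M]

lemma cubicForm_comm [CompleteSpace F] (hLC : IsLeviCivita g cov) (hι : IsImmersed F E ι)
    (hX : IsSmoothField X) (hY : IsSmoothField Y) (v : TangentSpace 𝓘(ℝ, F) p) :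
    cubicForm g cov J ι X Y p v = cubicForm g cov J ι Y X p v := by
  rw [cubicForm, sff_comm hLC hι hX hY, cubicForm]

variable [T2Space N]

lemma normalConn_J (hK : IsKaehler g cov J) (hι : IsImmersed F E ι)
    (hreal : IsTotallyReal F g J ι) (hY : IsSmoothField Y) :
    normalConn g cov ι X (fun q => J (ι q) (dι F E ι q (Y q))) p =
      J (ι p) (dι F E ι p (nabla g cov ι X Y p)) + fOp F g J ι (sff g cov ι X Y) p := by
  rw [normalConn, covAlong_J hK (hY.dι hι.smooth), ← dι_nabla_add_sff (g := g), map_add,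
    normalPart_add hι, normalPart_of_normal hι fun u => hreal p _ u, fOp]

lemma HasParallelF.fOp_sff (hf : HasParallelF F g cov J ι) (hK : IsKaehler g cov J)
    (hι : IsImmersed F E ι) (hreal : IsTotallyReal F g J ι) (hX : IsSmoothField X)
    (hY : IsSmoothField Y) : fOp F g J ι (sff g cov ι X Y) p = 0 := by
  have hparallel := hf X _ hX ((hY.dι hι.smooth).apply_J hK.smooth_J)
    (fun q v => by rw [g.symm, hreal]) p
  have hJnabla := congrFun (fOp_J (g := g) (X := nabla g cov ι X Y) hK hι) p
  refine fOp_eq_zero_of_fOp_fOp hK isNormal_sff ?_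
  rw [fOp] at hJnabla
  rw [fOp_J hK hι, normalConn_zero hι, fOp, normalConn_J hK hι hreal hY, map_add,
    normalPart_add hι, hJnabla, zero_add] at hparallel
  exact hparallel.symm

lemma HasParallelF.normalConn_J (hf : HasParallelF F g cov J ι) (hK : IsKaehler g cov J)
    (hι : IsImmersed F E ι) (hreal : IsTotallyReal F g J ι) (hX : IsSmoothField X)
    (hY : IsSmoothField Y) :
    normalConn g cov ι X (fun q => J (ι q) (dι F E ι q (Y q))) =
      fun q => J (ι q) (dι F E ι q (nabla g cov ι X Y q)) := by
  funext p
  rw [Submfd.normalConn_J hK hι hreal hY, hf.fOp_sff hK hι hreal hX hY, add_zero]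

/- Differentiate `g(Y, JZ) = 0` in the direction `X`. -/
lemma cubicForm_comm_right (hK : IsKaehler g cov J) (hι : IsImmersed F E ι)
    (hreal : IsTotallyReal F g J ι) (hY : IsSmoothField Y) (hZ : IsSmoothField Z) :
    cubicForm g cov J ι X Y p (Z p) = cubicForm g cov J ι X Z p (Y p) := by
  have hdY := hY.dι hι.smooth
  have hdZ := hZ.dι hι.smooth
  have hderiv := mvfderiv_inner_along hK.leviCivita hdY (hdZ.apply_J hK.smooth_J) (X p)
  have horth : (fun q => g.inner (ι q) (dι F E ι q (Y q)) (J (ι q) (dι F E ι q (Z q)))) =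
      fun _ => 0 := funext fun q => by rw [g.symm, hreal]
  rw [horth, mvfderiv_const, zero_apply, covAlong_J hK hdZ, hreal.inner_covAlong_J, g.symm,
    hK.inner_J_left, hreal.inner_covAlong_J] at hderiv
  linarith

variable [FiniteDimensional ℝ F]

lemma cubicForm_eq_zero (hK : IsKaehler g cov J) (hι : IsImmersed F E ι)
    (hreal : IsTotallyReal F g J ι)
    (hdiag : ∀ X : ∀ p : M, TangentSpace 𝓘(ℝ, F) p, IsSmoothField X →
      cubicForm g cov J ι X X p (X p) = 0)
    (hX : IsSmoothField X) (hY : IsSmoothField Y) (hZ : IsSmoothField Z) :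
    cubicForm g cov J ι X Y p (Z p) = 0 := by
  have : CompleteSpace F := FiniteDimensional.complete ℝ F
  exact trilinear_eq_zero (V := smoothFields F M)
    (T := fun X Y Z => cubicForm g cov J ι X.1 Y.1 p (Z.1 p))
    (fun X Y _ => cubicForm_comm hK.leviCivita hι X.2 Y.2 _)
    (fun _ Y Z => cubicForm_comm_right hK hι hreal Y.2 Z.2)
    (fun _ _ _ _ => cubicForm_add _ _) (fun X => hdiag X.1 X.2) ⟨X, hX⟩ ⟨Y, hY⟩ ⟨Z, hZ⟩

lemma HasParallelF.normalCurv_J (hf : HasParallelF F g cov J ι) (hK : IsKaehler g cov J)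
    (hι : IsImmersed F E ι) (hreal : IsTotallyReal F g J ι) (hX : IsSmoothField X)
    (hY : IsSmoothField Y) (hZ : IsSmoothField Z) :
    normalCurv g cov ι X Y (fun q => J (ι q) (dι F E ι q (Z q))) p =
      J (ι p) (dι F E ι p (curv g cov ι X Y Z p)) := by
  have : CompleteSpace F := FiniteDimensional.complete ℝ F
  rw [normalCurv, hf.normalConn_J hK hι hreal hX hZ, hf.normalConn_J hK hι hreal hY hZ,
    hf.normalConn_J hK hι hreal (hX.mlieBracket hY) hZ,
    hf.normalConn_J hK hι hreal hX (hY.nabla hK.leviCivita hι hZ),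
    hf.normalConn_J hK hι hreal hY (hX.nabla hK.leviCivita hι hZ), curv]
  simp only [map_sub]

lemma HasParallelF.exists_sff_eq_J (hf : HasParallelF F g cov J ι) (hK : IsKaehler g cov J)
    (hι : IsImmersed F E ι) (hreal : IsTotallyReal F g J ι) (hX : IsSmoothField X)
    (hY : IsSmoothField Y) :
    ∃ W, IsSmoothField W ∧ sff g cov ι X Y = fun q => J (ι q) (dι F E ι q (W q)) := by
  have hJσ := (hX.sff (g := g) hK.leviCivita hι hY).apply_J hK.smooth_J
  refine ⟨_, IsSmoothAlong.neg (ι := fun q : M => q) (hJσ.tangentPart (g := g) hι),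
    funext fun q => ?_⟩
  have hfσ := hf.fOp_sff (p := q) hK hι hreal hX hY
  rw [fOp, normalPart, sub_eq_zero] at hfσ
  rw [map_neg, ← hfσ, map_neg, hK.J_sq, neg_neg]

/- Since `R^⊥ J = J R` and `R(X, Y)` is skew, semiparallelity says that the cubic form is invariant
under `R(X, Y)`. -/
lemma IsSemiparallel.cubicForm_curv (hsemi : IsSemiparallel F g cov ι)
    (hf : HasParallelF F g cov J ι) (hK : IsKaehler g cov J) (hι : IsImmersed F E ι)
    (hreal : IsTotallyReal F g J ι) (hX : IsSmoothField X) (hY : IsSmoothField Y)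
    (hZ : IsSmoothField Z) (hU : IsSmoothField U) (hV : IsSmoothField V) :
    cubicForm g cov J ι U V p (curv g cov ι X Y Z p)
      + cubicForm g cov J ι Z V p (curv g cov ι X Y U p)
      + cubicForm g cov J ι Z U p (curv g cov ι X Y V p) = 0 := by
  have : CompleteSpace F := FiniteDimensional.complete ℝ F
  have hLC := hK.leviCivita
  have hRZ := hX.curv hLC hι hY hZ
  have hRU := hX.curv hLC hι hY hU
  obtain ⟨W, hW, hσ⟩ := hf.exists_sff_eq_J hK hι hreal hZ hU
  have hnormal : g.inner (ι p) (normalCurv g cov ι X Y (sff g cov ι Z U) p)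
      (J (ι p) (dι F E ι p (V p))) = -cubicForm g cov J ι Z U p (curv g cov ι X Y V p) := by
    rw [← metric_eq_cubicForm hK hσ, metric_comm, ← metric_curv_antisymm hLC hι hX hY hW hV, hσ,
      hf.normalCurv_J hK hι hreal hX hY hW, hK.J_isometry, metric]
  have hσZ : g.inner (ι p) (sff g cov ι (curv g cov ι X Y Z) U p)
      (J (ι p) (dι F E ι p (V p))) = cubicForm g cov J ι U V p (curv g cov ι X Y Z p) := by
    rw [← cubicForm_comm_right hK hι hreal hRZ hV, ← cubicForm_comm hLC hι hRZ hU, cubicForm]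
  have hσU : g.inner (ι p) (sff g cov ι Z (curv g cov ι X Y U) p)
      (J (ι p) (dι F E ι p (V p))) = cubicForm g cov J ι Z V p (curv g cov ι X Y U p) := by
    rw [← cubicForm_comm_right hK hι hreal hRU hV, cubicForm]
  have hinner := congrArg (fun ν => g.inner (ι p) ν (J (ι p) (dι F E ι p (V p))))
    (hsemi X Y Z U hX hY hZ hU p)
  simp only [map_sub, sub_apply, map_zero, zero_apply, hnormal, hσZ, hσU] at hinner
  linarith

variable [T2Space M] {c : ℝ}

lemma IsSemiparallel.cubicForm_orthogonal_eq_zero (hsemi : IsSemiparallel F g cov ι)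
    (hf : HasParallelF F g cov J ι) (hK : IsKaehler g cov J) (hι : IsImmersed F E ι)
    (hreal : IsTotallyReal F g J ι) (hc : HasConstantCurvature F g cov ι c) (hc0 : c ≠ 0)
    (hX : IsSmoothField X) (hY : IsSmoothField Y) (hXY : metric g ι p (X p) (Y p) = 0)
    (hYp : Y p ≠ 0) : cubicForm g cov J ι Y Y p (X p) = 0 := by
  have hYY : metric g ι p (Y p) (Y p) ≠ 0 := mt (eq_zero_of_metric_self hι) hYp
  have hinvariant := hsemi.cubicForm_curv hf hK hι hreal hX hY hY hY hY (p := p)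
  simp only [hc.curv_eq hK.leviCivita hι hX hY hY, hXY, zero_smul, sub_zero,
    cubicForm_smul] at hinvariant
  have hprod : c * metric g ι p (Y p) (Y p) * cubicForm g cov J ι Y Y p (X p) = 0 := by linarith
  exact (mul_eq_zero.1 hprod).resolve_left (mul_ne_zero hc0 hYY)

lemma IsSemiparallel.cubicForm_self_eq_zero (hsemi : IsSemiparallel F g cov ι)
    (hf : HasParallelF F g cov J ι) (hK : IsKaehler g cov J) (hι : IsImmersed F E ι)
    (hreal : IsTotallyReal F g J ι) (hc : HasConstantCurvature F g cov ι c) (hc0 : c ≠ 0)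
    (hF : 1 < Module.finrank ℝ F) (hX : IsSmoothField X) :
    cubicForm g cov J ι X X p (X p) = 0 := by
  obtain ⟨w, hw, hXw⟩ := exists_ne_zero_metric_eq_zero (g := g) (ι := ι) hF (X p)
  have : CompleteSpace F := FiniteDimensional.complete ℝ F
  obtain ⟨Y, hY, rfl⟩ := exists_isSmoothField_eq p w
  have hYY : metric g ι p (Y p) (Y p) ≠ 0 := mt (eq_zero_of_metric_self hι) hw
  have hYX : metric g ι p (Y p) (X p) = 0 := (metric_comm _ _).trans hXw
  have hXYY : cubicForm g cov J ι X Y p (Y p) = 0 := by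
    rw [cubicForm_comm hK.leviCivita hι hX hY, cubicForm_comm_right hK hι hreal hX hY]
    exact hsemi.cubicForm_orthogonal_eq_zero hf hK hι hreal hc hc0 hX hY hXw hw
  have hinvariant := hsemi.cubicForm_curv hf hK hι hreal hX hY hX hX hY (p := p)
  simp only [hc.curv_eq hK.leviCivita hι hX hY hX, hc.curv_eq hK.leviCivita hι hX hY hY, hXw, hYX,
    cubicForm_smul, cubicForm_sub, hXYY] at hinvariant
  have hprod : c * metric g ι p (Y p) (Y p) * cubicForm g cov J ι X X p (X p) = 0 := by linarith
  exact (mul_eq_zero.1 hprod).resolve_left (mul_ne_zero hc0 hYY)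

end TotallyReal

end Submfd

end

theorem theorem1 {n m : ℕ} (hn : 1 < n)
    {E : Type*} [NormedAddCommGroup E] [NormedSpace ℝ E] [FiniteDimensional ℝ E]
    (hE : Module.finrank ℝ E = 2 * m)
    {N : Type*} [TopologicalSpace N] [T2Space N] [ChartedSpace E N] [IsManifold 𝓘(ℝ, E) ∞ N]
    (g : ContMDiffRiemannianMetric 𝓘(ℝ, E) ∞ E (fun x : N => TangentSpace 𝓘(ℝ, E) x))
    (cov : CovariantDerivative 𝓘(ℝ, E) E (fun x : N => TangentSpace 𝓘(ℝ, E) x))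
    (J : ∀ x : N, TangentSpace 𝓘(ℝ, E) x →L[ℝ] TangentSpace 𝓘(ℝ, E) x)
    (hN : IsKaehler g cov J)
    {F : Type*} [NormedAddCommGroup F] [NormedSpace ℝ F] [FiniteDimensional ℝ F]
    (hF : Module.finrank ℝ F = n)
    {M : Type*} [TopologicalSpace M] [T2Space M] [ChartedSpace F M] [IsManifold 𝓘(ℝ, F) ∞ M]
    (ι : M → N) (hι : Submfd.IsImmersed F E ι)
    (hreal : Submfd.IsTotallyReal F g J ι)
    (hf : Submfd.HasParallelF F g cov J ι)
    (hsemi : Submfd.IsSemiparallel F g cov ι)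
    (c : ℝ) (hc : Submfd.HasConstantCurvature F g cov ι c) :
    c = 0 ∨ Submfd.IsTotallyGeodesic F g cov ι := by
  refine or_iff_not_imp_left.2 fun hc0 X Y hX hY p => ?_
  obtain ⟨W, hW, hσ⟩ := hf.exists_sff_eq_J hN hι hreal hX hY
  have hdiag : ∀ Z, Submfd.IsSmoothField Z → Submfd.cubicForm g cov J ι Z Z p (Z p) = 0 :=
    fun Z hZ => hsemi.cubicForm_self_eq_zero hf hN hι hreal hc hc0 (hF ▸ hn) hZ
  have hWW : Submfd.metric g ι p (W p) (W p) = 0 :=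
    (Submfd.metric_eq_cubicForm hN hσ _).trans
      (Submfd.cubicForm_eq_zero hN hι hreal hdiag hX hY hW)
  have hWp : W p = 0 := Submfd.eq_zero_of_metric_self hι hWW
  calc Submfd.sff g cov ι X Y p = J (ι p) (Submfd.dι F E ι p (W p)) := congrFun hσ p
    _ = 0 := by rw [hWp, map_zero, map_zero]
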